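/- **Setting.** Let $Q\subset\mathbb R^{n_q}$ be open and consider a robot with state $x=(q,\dot q)$, smooth positive definite inertia matrix $D(q)$, Coriolis matrix $C(q,\dot q)$ (Christoffel symbols of $D$), gravity $G=\nabla V$ with $V$ smooth, constant input matrix $B$ of rank $m$, and smooth scalar contact constraints $\eta_c$. The domains $v\in\mathcal V$ ($|\mathcal V|=N<\infty$) form a directed cycle $v\to\mu(v)$. In domain $v$ a finite set $\mathcal C_v$ of contacts is active, with Jacobian $J_v=\partial(\eta_c)_{c\in\mathcal C_v}/\partial q$. The state manifold is $\mathcal X_v=\{q\in Q,\ \eta_c(q)=0\ (c\in\mathcal C_v^0),\ J_v(q)\dot q=0\}$, where $\mathcal C^0_v\subseteq\mathcal C_v$ (for instance $\mathcal C_v^0=\mathcal C_v$); $J_v(q)$ has full rank for all $q\in Q$ with $\eta_c(q)=0$, $c\in\mathcal C^0_v$. The constrained dynamics $D\ddot q+C\dot q+G=Bu+J_v^\top\lambda$, $J_v\ddot q+\frac{\partial}{\partial q}(J_v\dot q)\dot q=0$ are written as $\dot x=f_v(x)+g_v(x)u$. The transition $v\to\mu(v)$ occurs on a guard $\mathcal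 S_v\subset\mathcal D_v\subset\mathcal X_v\times\mathcal U_v$, relatively closed in the domain of admissibility $\mathcal D_v$. Its reset $\Delta_v$ is the identity if $\mathcal C_{\mu(v)}\subseteq\mathcal C_v$, and otherwise the rigid impact $D(\dot q^+-\dot q^-)=J_{\mu(v)}^\top\delta\lambda$, $J_{\mu(v)}\dot q^+=0$, $q^+=q^-$; moreover $\Delta_v(x)\in\mathcal X_{\mu(v)}$ whenever $(x,u)\in\mathcal S_v$ for some $u$. A solution on $[0,\infty)$ is a right-continuous $(x(t),u(t))\in\mathcal D_{v(t)}$ with left limits, active domain $v(t)$ and a locally finite set of switching times in $(0,\infty)$. Between switching times it satisfies the differential equation, $v(t)$ is constant and $(x^-,u^-)\notin\mathcal S_{v(t)}$; at a switching time out of $v$, $(x^-,u^-)\in\mathcal S_v$, $x=\Delta_v(x^-)$, and the new active domain is $\mu(v)$. **Assumptions.** 1. (Periodic orbit) $(x^\star,u^\star)$ with active domain $v(t)$ is a solution on $[0,\infty)$ with fundamental period $T^\star>0$; $\mathcal O_v:=\{x^\star(t):t\in[0,T^\star),\ v(t)=v\}$. 2. (Phasing variable) $\tau_v:Q\to\mathbb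 R$ is $C^\infty$, and $\tau_v(q^\star(t))$ is strictly increasing in $t$ during each stay in $v$. 3. (Controllers) For $\xi_v$ in the open set $\Xi_v\subset\mathbb R^{p_v}$, the outputs of domain $v$ are $y_{2v}=H_{2v}(\xi_v)(q-q^\star(\tau_v,v))\in\mathbb R^{m_{2v}}$ and, if $v$ is a multi-contact domain, also $y_{1v}=J_{s,v}(q)\dot q-s^\star(\tau_v,v)\in\mathbb R$; in single-contact domains $m_{2v}=m$. Here $H_{2v}$, $J_{s,v}$, $q^\star(\cdot,v)$, $s^\star(\cdot,v)$ are smooth, and the last two are the evolutions of $q$ and (in multi-contact domains) of $J_{s,v}\dot q$ along $\mathcal O_v$ in terms of $\tau_v$. With $A_v,b_v$ the decoupling matrix and drift term of $(\dot y_{1v},\ddot y_{2v})$ and $w_v=(k_py_{1v},\,k_py_{2v}+k_d\dot y_{2v})$, $k_p,k_d>0$, the controller is $\Gamma_v(x,\xi_v)=-A_v^\top(A_vA_v^\top)^{-1}(b_v+w_v)$, where $A_v(x,\xi_v)$ has full row rank for all $x\in\overline{\mathcal O}_v$, $\xi_v\in\Xi_v$. The closed-loop field is $f_v^{\rm cl}=f_v+g_v\Gamma_v$,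 considered on those $x\in\mathcal X_v$ at which $A_v(x,\xi_v)$ has full row rank. 4. (Nominal parameters) There is $\xi^\star\in\Xi:=\prod_v\Xi_v$ with $\Gamma_{v(t)}(x^\star(t),\xi^\star_{v(t)})=u^\star(t)$ for all $t\in[0,T^\star)$. 5. (Regularity) The sets $\hat{\mathcal S}_v(\xi_v)=\{x\in\mathcal X_v: A_v(x,\xi_v)\text{ has full row rank},\ (x,\Gamma_v(x,\xi_v))\in\mathcal S_v\}$ are embedded submanifolds of $\mathcal X_v$ of codimension one that depend smoothly on $\xi_v\in\Xi_v$: near each $(x_0,\xi_0)$ with $\xi_0\in\Xi_v$ and $x_0\in\hat{\mathcal S}_v(\xi_0)$ they are given in $\mathcal X_v$ by $h(x,\xi_v)=0$, with $h$ of class $C^\infty$ and $\partial_xh(x_0,\xi_0)\ne0$ on the tangent space of $\mathcal X_v$ at $x_0$. 6. (Transversality) For all $v$ and $\xi_v\in\Xi_v$, $\overline{\mathcal O}_v\cap\hat{\mathcal S}_v(\xi_v)$ is a single point, at which the tangent vector $f_v^{\rm cl}(\cdot,\xi_v^\star)$ of the orbit is not tangent to $\hat{\mathcal S}_v(\xi_v)$.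 **Poincaré map.** $P_v(x,\xi_v)$ is the first point (at a time $t>0$) at which the closed-loop solution of domain $v$ that starts at $\Delta_{\mu^{-1}(v)}(x)$ meets $\hat{\mathcal S}_v(\xi_v)$, and, for a fixed domain $v_1$, $P(\cdot,\xi):=P_{v_1}(\cdot,\xi_{v_1})\circ P_{\mu^{N-1}(v_1)}(\cdot,\xi_{\mu^{N-1}(v_1)})\circ\cdots\circ P_{\mu(v_1)}(\cdot,\xi_{\mu(v_1)})$ on $\hat{\mathcal S}_{v_1}(\xi_{v_1})$. **Theorem.** Let $v_1\in\mathcal V$. There are a set $\hat\Xi\subset\Xi$ and a point $x_1^\star\in\overline{\mathcal O}_{v_1}$ such that * $\hat\Xi$ contains $\xi^\star$ and, more generally, every $\xi\in\Xi$ with $\Gamma_{v(t)}(x^\star(t),\xi_{v(t)})=u^\star(t)$ for all $t\in[0,T^\star)$; * for every $\xi\in\hat\Xi$, $x_1^\star\in\hat{\mathcal S}_{v_1}(\xi_{v_1})$, $P(x_1^\star,\xi)$ is defined and $P(x_1^\star,\xi)=x_1^\star$; * for every $\xi_0\in\hat\Xi$ and all $(x,\xi)$ near $(x_1^\star,\xi_0)$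 with $x\in\hat{\mathcal S}_{v_1}(\xi_{v_1})$, $P(x,\xi)$ is defined, lies in $\hat{\mathcal S}_{v_1}(\xi_{v_1})$, and is the value at $(x,\xi)$ of a map that is of class $C^2$ near $(x_1^\star,\xi_0)$ in the state and parameter spaces; * the Jacobian $\Psi(\xi)=\frac{\partial P}{\partial x}(x_1^\star,\xi)$ of $P(\cdot,\xi)$ along $\hat{\mathcal S}_{v_1}(\xi_{v_1})$ exists for every $\xi\in\hat\Xi$ and, represented by a linear map of $\mathbb R^{2n_q}$, can be chosen differentiable in $\xi$ on $\hat\Xi$. -/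

import Mathlib

open Set Filter Topology
open scoped ContDiff Matrix

noncomputable section

/-- Column vectors with `n` real components. -/
abbrev Vec (n : ℕ) := Fin n → ℝ

/-- States `x = (q, q')` of a mechanical system with `nq` degrees of freedom, in coordinates. -/
abbrev State (nq : ℕ) := Vec nq × Vec nq

/-- The mechanical data of a robot in generalized coordinates: an open coordinate domain `Q`,
the mass-inertia matrix `D`, the potential energy `pot`, the (constant) input distribution matrix
`B`, and a family `η` of scalar holonomic contact constraints, indexed by `Con`. -/
structure Robot (nq m : ℕ) (Con : Type*) where
  Q : Set (Vec nq)
  isOpen_Q : IsOpen Q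
  D : Vec nq → Matrix (Fin nq) (Fin nq) ℝ
  smooth_D : ∀ i j, ContDiffOn ℝ ∞ (fun q => D q i j) Q
  posDef_D : ∀ q ∈ Q, (D q).PosDef
  pot : Vec nq → ℝ
  smooth_pot : ContDiffOn ℝ ∞ pot Q
  B : Matrix (Fin nq) (Fin m) ℝ
  rank_B : B.rank = m
  η : Con → Vec nq → ℝ
  smooth_η : ∀ c, ContDiffOn ℝ ∞ (η c) Q

namespace Robot

variable {nq m : ℕ} {Con : Type*} (R : Robot nq m Con)

/-- `∂ D i j / ∂ q_k`. -/
def dD (q : Vec nq) (k i j : Fin nq) : ℝ :=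
  fderiv ℝ (fun q' => R.D q' i j) q (Pi.single k 1)

/-- The Coriolis and centrifugal matrix `C(q, q')`, through the Christoffel symbols of `D`. -/
def coriolis (q dq : Vec nq) : Matrix (Fin nq) (Fin nq) ℝ :=
  Matrix.of fun i j => ∑ k, (1 / 2 : ℝ) * (R.dD q k i j + R.dD q j i k - R.dD q i k j) * dq k

/-- The gravitational terms `G(q)`. -/
def gravity (q : Vec nq) : Vec nq := fun i => fderiv ℝ R.pot q (Pi.single i 1)

/-- `F(q, q') = C(q, q') q' + G(q)`. -/
def drift (q dq : Vec nq) : Vec nq := R.coriolis q dq *ᵥ dq + R.gravity q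

variable [DecidableEq Con] (K : Finset Con)

/-- The Jacobian `J(q)` of the holonomic constraints in `K`. -/
def jac (q : Vec nq) : Matrix K (Fin nq) ℝ :=
  Matrix.of fun c j => fderiv ℝ (R.η c) q (Pi.single j 1)

/-- The term `(∂/∂q (J(q) q')) q'`. -/
def jacDot (q dq : Vec nq) : K → ℝ :=
  fun c => fderiv ℝ (fun q' => (R.jac K q' *ᵥ dq) c) q dq

/-- `J D⁻¹ Jᵀ`. -/
def contactInertia (q : Vec nq) : Matrix K K ℝ := R.jac K q * (R.D q)⁻¹ * (R.jac K q)ᵀ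

/-- The projection `I - Jᵀ (J D⁻¹ Jᵀ)⁻¹ J D⁻¹`. -/
def proj (q : Vec nq) : Matrix (Fin nq) (Fin nq) ℝ :=
  1 - (R.jac K q)ᵀ * (R.contactInertia K q)⁻¹ * R.jac K q * (R.D q)⁻¹

/-- The term `F_v` of the constrained dynamics `D q'' + F_v = T_v u`. -/
def constrainedDrift (q dq : Vec nq) : Vec nq :=
  R.proj K q *ᵥ R.drift q dq +
    (R.jac K q)ᵀ *ᵥ ((R.contactInertia K q)⁻¹ *ᵥ R.jacDot K q dq)

/-- The matrix `T_v` of the constrained dynamics `D q'' + F_v = T_v u`. -/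
def constrainedInput (q : Vec nq) : Matrix (Fin nq) (Fin m) ℝ := R.proj K q * R.B

/-- The velocity after a rigid impact that enforces the constraints in `K`: the solution `dq⁺` of
`D dq⁺ - D dq⁻ = Jᵀ δλ`, `J dq⁺ = 0`. -/
def impact (q dq : Vec nq) : Vec nq :=
  dq - (R.D q)⁻¹ *ᵥ ((R.jac K q)ᵀ *ᵥ ((R.contactInertia K q)⁻¹ *ᵥ (R.jac K q *ᵥ dq)))

end Robot

/-- The open-loop multi-domain hybrid model. `V` is the set of domains, `next` the index of the
next domain function `μ`, `contact v` the set of holonomic constraints of the domain `v`,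
`U v` the admissible controls, `adm v` the domain of admissibility, and `guard v` the guard of
the transition `v → μ v`.

The contact constraints of a domain always enter through `J_v(q) q' = 0`. Those in `pinned v` are
in addition imposed at the level of positions, `η_c(q) = 0`. With `pinned v = contact v` the state
manifold is `{η_v(q) = 0, J_v(q) q' = 0}`; a smaller set `pinned v` allows a foot to keep
whatever horizontal position it has landed at. -/
structure HybridModel (nq m : ℕ) (Con V : Type*) extends Robot nq m Con where
  next : Equiv.Perm V
  contact : V → Finset Con
  pinned : V → Finset Con
  pinned_subset : ∀ v, pinned v ⊆ contact v
  U : V → Set (Vec m)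
  adm : V → Set (State nq × Vec m)
  guard : V → Set (State nq × Vec m)

namespace HybridModel

variable {nq m : ℕ} {Con V : Type*} [DecidableEq Con] (M : HybridModel nq m Con V)

/-- The state manifold of the domain `v`. -/
def X (v : V) : Set (State nq) :=
  {x | x.1 ∈ M.Q ∧ (∀ c ∈ M.pinned v, M.η c x.1 = 0) ∧ M.jac (M.contact v) x.1 *ᵥ x.2 = 0}

/-- The drift vector field `f_v`. -/
def f (v : V) (x : State nq) : State nq :=
  (x.2, -((M.D x.1)⁻¹ *ᵥ M.constrainedDrift (M.contact v) x.1 x.2))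

/-- The control vector fields: `g v x u` is `g_v(x) u`. -/
def g (v : V) (x : State nq) (u : Vec m) : State nq :=
  (0, (M.D x.1)⁻¹ *ᵥ (M.constrainedInput (M.contact v) x.1 *ᵥ u))

/-- The reset law `Δ` of the transition `v → μ v`: the identity if contacts only break, and the
rigid impact that enforces the constraints of `μ v` if there is a new contact. -/
def reset (v : V) (x : State nq) : State nq :=
  if M.contact (M.next v) ⊆ M.contact v then x
  else (x.1, M.impact (M.contact (M.next v)) x.1 x.2)

/-- The conditions under which the data form a multi-domain hybrid model: the graph is a directed
cycle, the Jacobians `J_v` have full rank, guards are relatively closed subsets of the domains of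
admissibility, and resets map guards to the state manifold of the next domain. -/
structure IsModel : Prop where
  cycle : M.next.IsCycleOn univ
  rank_jac : ∀ v, ∀ q ∈ M.Q, (∀ c ∈ M.pinned v, M.η c q = 0) →
    (M.jac (M.contact v) q).rank = (M.contact v).card
  adm_subset : ∀ v, M.adm v ⊆ M.X v ×ˢ M.U v
  guard_subset : ∀ v, M.guard v ⊆ M.adm v
  guard_closed : ∀ v, closure (M.guard v) ∩ M.adm v ⊆ M.guard v
  reset_mem : ∀ v, ∀ z ∈ M.guard v, M.reset v z.1 ∈ M.X (M.next v)

end HybridModel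

/-- A hybrid trajectory on `[0, ∞)`: at time `t` the active domain is `vertex t`, the state is
`x t` and the control is `u t`; `sw` is the set of switching times. The state `x(t, v)` in the
domain `v` at time `t` is `x t`, for those `t` at which `vertex t = v`. -/
structure HybridArc (nq m : ℕ) (V : Type*) where
  vertex : ℝ → V
  x : ℝ → State nq
  u : ℝ → Vec m
  sw : Set ℝ

namespace HybridArc

variable {nq m : ℕ} {Con V : Type*} [DecidableEq Con]

/-- `a` is a solution on `[0, ∞)` of the open-loop hybrid model `M`. -/
structure IsSolution (M : HybridModel nq m Con V) (a : HybridArc nq m V) : Prop where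
  sw_pos : a.sw ⊆ Ioi 0
  sw_finite : ∀ b : ℝ, (a.sw ∩ Iic b).Finite
  mem_adm : ∀ t, 0 ≤ t → (a.x t, a.u t) ∈ M.adm (a.vertex t)
  right_cont : ∀ t, 0 ≤ t → ContinuousWithinAt a.x (Ici t) t ∧ ContinuousWithinAt a.u (Ici t) t ∧
    ∀ᶠ s in 𝓝[≥] t, a.vertex s = a.vertex t
  left_lim : ∀ t, 0 < t → ∃ (v : V) (xm : State nq) (um : Vec m),
    (∀ᶠ s in 𝓝[<] t, a.vertex s = v) ∧
    Tendsto a.x (𝓝[<] t) (𝓝 xm) ∧ Tendsto a.u (𝓝[<] t) (𝓝 um) ∧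
    (t ∉ a.sw → a.vertex t = v ∧ (xm, um) ∉ M.guard v) ∧
    (t ∈ a.sw → a.vertex t = M.next v ∧ (xm, um) ∈ M.guard v ∧ a.x t = M.reset v xm)
  ode : ∀ t, 0 ≤ t → t ∉ a.sw →
    HasDerivWithinAt a.x (M.f (a.vertex t) (a.x t) + M.g (a.vertex t) (a.x t) (a.u t)) (Ici 0) t

/-- `T` is the fundamental period of `a`. -/
def IsFundamentalPeriod (a : HybridArc nq m V) (T : ℝ) : Prop :=
  IsLeast {T' : ℝ | 0 < T' ∧ ∀ t, 0 ≤ t →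
    a.x (t + T') = a.x t ∧ a.u (t + T') = a.u t ∧ a.vertex (t + T') = a.vertex t} T

/-- The part `O_v` of the periodic orbit in the domain `v`. -/
def orbit (a : HybridArc nq m V) (T : ℝ) (v : V) : Set (State nq) :=
  {x | ∃ t ∈ Ico 0 T, a.vertex t = v ∧ a.x t = x}

/-- `τ` is smooth, and along the orbit it is a strictly increasing function of time during every
stay in a domain. Phasing variables are holonomic, that is, functions of the configuration. -/
def IsPhasing (M : HybridModel nq m Con V) (a : HybridArc nq m V) (τ : V → Vec nq → ℝ) : Prop :=
  (∀ v, ContDiffOn ℝ ∞ (τ v) M.Q) ∧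
  ∀ t t', 0 ≤ t → t < t' → Disjoint a.sw (Ioc t t') →
    τ (a.vertex t) (a.x t).1 < τ (a.vertex t') (a.x t').1

end HybridArc

/-- The data of a family of virtual constraint controllers: for each domain `v`, the number `p v`
of parameters, the set `Ξ v` of admissible parameters, the phasing variable `τ v`, the kind of the
domain (`multi v = true` for a multi-contact and `false` for a single-contact domain), the number
`m2 v` of holonomic outputs, the output matrix `H v`, the row `Js v` giving the forward speed
`s = Js v q * q'`, the desired evolutions `qd v` and `sd v` of `q` and `s` in terms of the phasing
variable, and the gains `kp`, `kd`. -/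
structure ControlFamily (nq : ℕ) (V : Type*) where
  p : V → ℕ
  Ξ : (v : V) → Set (Vec (p v))
  τ : V → Vec nq → ℝ
  multi : V → Bool
  m2 : V → ℕ
  H : (v : V) → Vec (p v) → Matrix (Fin (m2 v)) (Fin nq) ℝ
  Js : V → Vec nq → Vec nq
  qd : V → ℝ → Vec nq
  sd : V → ℝ → ℝ
  kp : ℝ
  kd : ℝ

namespace ControlFamily

variable {nq m : ℕ} {Con V : Type*} [DecidableEq Con]

/-- The index set of the outputs of the domain `v`: one nonholonomic output if `v` is
a multi-contact domain, none otherwise, followed by the `m2 v` holonomic outputs. -/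
abbrev Row (c : ControlFamily nq V) (v : V) := Fin (bif c.multi v then 1 else 0) ⊕ Fin (c.m2 v)

/-- The parameter vectors `ξ` of all domains together. -/
abbrev Params (c : ControlFamily nq V) := (v : V) → Vec (c.p v)

/-- The set of admissible parameter vectors, the product of the sets `Ξ v`. -/
def allParams (c : ControlFamily nq V) : Set c.Params := {ξ | ∀ v, ξ v ∈ c.Ξ v}

/-- The nonholonomic output `y1 = s(q, q') - s*(τ)`. -/
def y1 (c : ControlFamily nq V) (v : V) (x : State nq) : ℝ :=
  c.Js v x.1 ⬝ᵥ x.2 - c.sd v (c.τ v x.1)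

/-- The holonomic output `y2 = H(ξ) (q - q*(τ))`. -/
def y2 (c : ControlFamily nq V) (v : V) (ξ : Vec (c.p v)) (i : Fin (c.m2 v)) (x : State nq) : ℝ :=
  (c.H v ξ *ᵥ (x.1 - c.qd v (c.τ v x.1))) i

/-- The Lie derivative of `h` along `f_v`. -/
def lieF (M : HybridModel nq m Con V) (v : V) (h : State nq → ℝ) (x : State nq) : ℝ :=
  fderiv ℝ h x (M.f v x)

/-- The Lie derivatives of `h` along the columns of `g_v`. -/
def lieG (M : HybridModel nq m Con V) (v : V) (h : State nq → ℝ) (x : State nq) : Vec m :=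
  fun j => fderiv ℝ h x (M.g v x (Pi.single j 1))

variable (c : ControlFamily nq V) (M : HybridModel nq m Con V)

/-- The decoupling matrix `A_v(x, ξ_v)`. -/
def decoupling (v : V) (ξ : Vec (c.p v)) (x : State nq) : Matrix (c.Row v) (Fin m) ℝ :=
  Matrix.of (Sum.elim (fun _ => lieG M v (c.y1 v) x)
    (fun i => lieG M v (lieF M v (c.y2 v ξ i)) x))

/-- The vector `b_v(x, ξ_v)`. -/
def bvec (v : V) (ξ : Vec (c.p v)) (x : State nq) : c.Row v → ℝ :=
  Sum.elim (fun _ => lieF M v (c.y1 v) x) (fun i => lieF M v (lieF M v (c.y2 v ξ i)) x)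

/-- The vector `w_v(x, ξ_v)` of the linear output feedback. -/
def wvec (v : V) (ξ : Vec (c.p v)) (x : State nq) : c.Row v → ℝ :=
  Sum.elim (fun _ => c.kp * c.y1 v x)
    (fun i => c.kp * c.y2 v ξ i x + c.kd * lieF M v (c.y2 v ξ i) x)

/-- The input-output linearizing controller `Γ_v(x, ξ_v) = -Aᵀ (A Aᵀ)⁻¹ (b + w)`. When `A` is
square and invertible (single-contact domains), `Aᵀ (A Aᵀ)⁻¹` is `A⁻¹`. -/
def Γ (v : V) (ξ : Vec (c.p v)) (x : State nq) : Vec m :=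
  -((c.decoupling M v ξ x)ᵀ *ᵥ ((c.decoupling M v ξ x * (c.decoupling M v ξ x)ᵀ)⁻¹ *ᵥ
    (c.bvec M v ξ x + c.wvec M v ξ x)))

/-- The decoupling matrix has full row rank at `x`. -/
def FullRank (v : V) (ξ : Vec (c.p v)) (x : State nq) : Prop :=
  (c.decoupling M v ξ x).rank = Fintype.card (c.Row v)

/-- The closed-loop vector field. -/
def fcl (v : V) (ξ : Vec (c.p v)) (x : State nq) : State nq :=
  M.f v x + M.g v x (c.Γ M v ξ x)

/-- The states of the domain `v` at which the controller is defined. -/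
def Xcl (v : V) (ξ : Vec (c.p v)) : Set (State nq) := {x | x ∈ M.X v ∧ c.FullRank M v ξ x}

/-- The reduced-order parameterized switching manifold of the transition `v → μ v`. -/
def switchSet (v : V) (ξ : Vec (c.p v)) : Set (State nq) :=
  {x | x ∈ c.Xcl M v ξ ∧ (x, c.Γ M v ξ x) ∈ M.guard v}

/-- `γ` is a solution on `[0, T]` of the closed-loop equation of the domain `v`, from `x0`. -/
def IsTrajectory (v : V) (ξ : Vec (c.p v)) (x0 : State nq) (T : ℝ) (γ : ℝ → State nq) : Prop :=
  γ 0 = x0 ∧ ∀ t ∈ Icc 0 T, γ t ∈ c.Xcl M v ξ ∧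
    HasDerivWithinAt γ (c.fcl M v ξ (γ t)) (Icc 0 T) t

open Classical in
/-- The flow `φ_v(t; x0, ξ_v)`; it is only meaningful when the solution from `x0` exists up to
time `t` (it is then unique). -/
def flow (v : V) (ξ : Vec (c.p v)) (t : ℝ) (x0 : State nq) : State nq :=
  if h : ∃ γ, c.IsTrajectory M v ξ x0 t γ then h.choose t else x0

/-- The positive times, within the interval of existence, at which the solution from `x0` meets
the switching manifold. -/
def hitTimes (v : V) (ξ : Vec (c.p v)) (x0 : State nq) : Set ℝ :=
  {t | 0 < t ∧ (∃ γ, c.IsTrajectory M v ξ x0 t γ) ∧ c.flow M v ξ t x0 ∈ c.switchSet M v ξ}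

/-- The time-to-switching function `T_v`. -/
def switchTime (v : V) (ξ : Vec (c.p v)) (x0 : State nq) : ℝ := sInf (c.hitTimes M v ξ x0)

/-- The state at which the domain `v` starts when the previous domain ends at `x`. -/
def start (v : V) (x : State nq) : State nq := M.reset (M.next.symm v) x

/-- The generalized Poincaré map `P_v` of the domain `v`. -/
def genPoincare (v : V) (ξ : Vec (c.p v)) (x : State nq) : State nq :=
  c.flow M v ξ (c.switchTime M v ξ (start M v x)) (start M v x)

/-- The composition of the generalized Poincaré maps of the first `k` domains after `v1`. -/
def partialReturn (v1 : V) (ξ : c.Params) : ℕ → State nq → State nq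
  | 0, x => x
  | k + 1, x => c.genPoincare M ((M.next ^ (k + 1)) v1) (ξ _) (partialReturn v1 ξ k x)

/-- The full-order Poincaré return map `P(x, ξ)` on the switching manifold of `v1`. -/
def returnMap [Fintype V] (v1 : V) (ξ : c.Params) (x : State nq) : State nq :=
  c.partialReturn M v1 ξ (Fintype.card V) x

/-- `P(x, ξ)` is defined: in each domain of the cycle, the solution does reach the switching
manifold and there is a first time at which it does. -/
def ReturnDefined [Fintype V] (v1 : V) (ξ : c.Params) (x : State nq) : Prop :=
  ∀ k < Fintype.card V, ∃ T, IsLeast (c.hitTimes M ((M.next ^ (k + 1)) v1) (ξ _)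
    (start M ((M.next ^ (k + 1)) v1) (c.partialReturn M v1 ξ k x))) T

/-- The conditions under which the data form a family of virtual constraint controllers for the
orbit of `a`: smooth data, as many outputs as inputs in single-contact domains, `qd` and `sd` are
the evolutions of `q` and of the forward speed along the orbit, and the decoupling matrices have
full rank near the orbit. -/
structure IsFamily (a : HybridArc nq m V) (T : ℝ) : Prop where
  isOpen_Ξ : ∀ v, IsOpen (c.Ξ v)
  smooth_H : ∀ v i j, ContDiffOn ℝ ∞ (fun ξ => c.H v ξ i j) (c.Ξ v)
  smooth_Js : ∀ v i, ContDiffOn ℝ ∞ (fun q => c.Js v q i) M.Q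
  smooth_qd : ∀ v, ContDiff ℝ ∞ (c.qd v)
  smooth_sd : ∀ v, ContDiff ℝ ∞ (c.sd v)
  kp_pos : 0 < c.kp
  kd_pos : 0 < c.kd
  square : ∀ v, c.multi v = false → c.m2 v = m
  qd_orbit : ∀ t, 0 ≤ t → c.qd (a.vertex t) (c.τ (a.vertex t) (a.x t).1) = (a.x t).1
  sd_orbit : ∀ t, 0 ≤ t → c.multi (a.vertex t) = true →
    c.sd (a.vertex t) (c.τ (a.vertex t) (a.x t).1) = c.Js (a.vertex t) (a.x t).1 ⬝ᵥ (a.x t).2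
  fullRank : ∀ v, ∀ ξ ∈ c.Ξ v, ∀ x ∈ closure (a.orbit T v), c.FullRank M v ξ x

/-- With the parameters `ξ` the controllers generate the nominal control along the orbit. -/
def GeneratesNominal (a : HybridArc nq m V) (T : ℝ) (ξ : c.Params) : Prop :=
  ∀ t ∈ Ico 0 T, c.Γ M (a.vertex t) (ξ (a.vertex t)) (a.x t) = a.u t

/-- The switching manifolds `switchSet v ξ`, for `ξ` in `Ξ v`, are embedded submanifolds of `X v`
of codimension one that depend smoothly on `ξ`: each has near each of its points a smooth local
defining function, that depends smoothly on the parameter as well. -/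
def RegularSections : Prop :=
  ∀ v, ∀ ξ0 ∈ c.Ξ v, ∀ x0 ∈ c.switchSet M v ξ0,
    ∃ (W : Set (State nq × Vec (c.p v))) (h : State nq × Vec (c.p v) → ℝ),
      IsOpen W ∧ (x0, ξ0) ∈ W ∧ ContDiffOn ℝ ∞ h W ∧
      (∀ z ∈ W, z.1 ∈ M.X v → z.2 ∈ c.Ξ v → (z.1 ∈ c.switchSet M v z.2 ↔ h z = 0)) ∧
      ∃ w ∈ tangentConeAt ℝ (M.X v) x0, fderiv ℝ (fun x => h (x, ξ0)) x0 w ≠ 0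

/-- The closure of `O_v` meets each switching manifold `switchSet v ξ`, for `ξ` in `Ξ v`, in exactly
one point, and there the orbit is transversal to it. The orbit is an integral curve of the
closed-loop vector field for the nominal parameters `ξs`, which is thus its tangent vector. -/
def Transversal (a : HybridArc nq m V) (T : ℝ) (ξs : c.Params) : Prop :=
  ∀ v, ∀ ξ ∈ c.Ξ v, ∃ x, closure (a.orbit T v) ∩ c.switchSet M v ξ = {x} ∧
    c.fcl M v (ξs v) x ∉ tangentConeAt ℝ (c.switchSet M v ξ) x

end ControlFamily

end

-- The nominal parameters play no special role: `Ξhat` consists of all admissible `ξ` whose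
-- controllers reproduce the nominal control along the orbit, and for each of them the orbit is a
-- closed-loop solution. By continuity of `Γ`, the control at the end of a stay in a domain is the
-- left limit of the nominal one. So the exit point of each domain lies on the switching manifold
-- for every such `ξ`, and by the single-point hypothesis it is the only point of the closed orbit
-- there (`exit_mem_switchSet`, `closure_orbit_inter_switchSet`). The exit point is thus independent
-- of `ξ`, and it is a common fixed point of the return maps.
--
-- Regularity follows the classical pattern: smooth flow, hitting time from the implicit function
-- theorem, composition around the cycle. Three points need care.
--
-- The equations live on state manifolds, but all formulas are smooth on an open set, where the
-- contact constraints are independent and the decoupling matrix has full row rank. The equation is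
-- solved there, with the parameters adjoined as constant states, and `mem_X_of_solution` brings
-- solutions back to the manifold. Smooth dependence on initial values comes from the implicit
-- function theorem in a space of curves (`contDiffOn_flow_small`, `exists_contDiff_flow`).
--
-- The nominal crossing must be transversal and must be the first one. `fderiv_fcl_ne_zero` turns
-- transversality, stated with tangent cones, into a nonzero derivative of the local defining
-- function. `exists_stay` uses the strict growth of the phasing variable to keep the orbit off the
-- closure of the guard before its exit. Compactness then excludes early crossings of nearby
-- solutions, and near the nominal time the crossing is unique (`exists_local_poincare`).
--
-- A linear map representing the Jacobian along the section is not determined off the tangent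
-- directions, and `Ξhat` need not be open. The representing maps form a convex set, however, so the
-- local choices obtained from `C²` extensions are glued by a partition of unity
-- (`exists_differentiableOn_forall_mem_convex`).

universe u

noncomputable section

/-! ### Superposition operators on spaces of continuous functions -/

section Superposition

variable {K : Type*} [TopologicalSpace K] [CompactSpace K]
  {E F : Type*} [NormedAddCommGroup E] [NormedSpace ℝ E] [NormedAddCommGroup F] [NormedSpace ℝ F]

/-- Pointwise application of a continuous family of operators to a continuous function. -/
def ContinuousMap.pointwiseApply : C(K, E →L[ℝ] F) →L[ℝ] C(K, E) →L[ℝ] C(K, F) :=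
  LinearMap.mkContinuous₂
    (LinearMap.mk₂ ℝ (fun (A : C(K, E →L[ℝ] F)) (γ : C(K, E)) =>
        (⟨fun t => A t (γ t), by fun_prop⟩ : C(K, F)))
      (by intros; ext; simp) (by intros; ext; simp) (by intros; ext; simp) (by intros; ext; simp))
    1 (by
      intro A γ
      rw [one_mul, ContinuousMap.norm_le _ (by positivity)]
      intro t
      refine ((A t).le_opNorm _).trans ?_
      gcongr
      · exact A.norm_coe_le_norm t
      · exact γ.norm_coe_le_norm t)

/-- The superposition operator of a `C¹` map is differentiable. -/
theorem ContDiff.hasFDerivAt_superposition {g : E → F} (hg : ContDiff ℝ 1 g) (γ : C(K, E)) :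
    HasFDerivAt (fun γ : C(K, E) => (⟨g, hg.continuous⟩ : C(E, F)).comp γ)
      (ContinuousMap.pointwiseApply
        ((⟨fderiv ℝ g, hg.continuous_fderiv (by simp)⟩ : C(E, E →L[ℝ] F)).comp γ)) γ := by
  set G' : C(E, E →L[ℝ] F) := ⟨fderiv ℝ g, hg.continuous_fderiv (by simp)⟩
  -- Postcomposition is continuous in the sup norm, so a single δ controls the variation of `fderiv
  -- ℝ g` near all points of the curve at once.
  have hcont : Continuous fun γ : C(K, E) => G'.comp γ := ContinuousMap.continuous_postcomp G'
  rw [hasFDerivAt_iff_isLittleO_nhds_zero, Asymptotics.isLittleO_iff]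
  intro ε hε
  obtain ⟨δ, hδ, hball⟩ :=
    (Metric.continuous_iff (α := C(K, E)) (β := C(K, E →L[ℝ] F))).1 hcont γ ε hε
  filter_upwards [Metric.ball_mem_nhds (0 : C(K, E)) hδ] with h hh
  rw [ContinuousMap.norm_le _ (by positivity)]
  intro t
  have hseg : ∀ s ∈ Icc (0 : ℝ) 1, ‖fderiv ℝ g (γ t + s • h t) - fderiv ℝ g (γ t)‖ ≤ ε := by
    intro s hs
    have h1 : Dist.dist (γ + s • h) γ < δ := by
      rw [dist_eq_norm, add_sub_cancel_left, norm_smul, Real.norm_of_nonneg hs.1]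
      have : ‖h‖ < δ := by simpa using hh
      nlinarith [norm_nonneg h, hs.2]
    have h2 := (ContinuousMap.dist_apply_le_dist t).trans (hball _ h1).le
    rwa [dist_eq_norm] at h2
  have key := Convex.norm_image_sub_le_of_norm_hasFDerivWithin_le' (f := g)
    (f' := fun y => fderiv ℝ g y) (φ := fderiv ℝ g (γ t)) (C := ε)
    (s := segment ℝ (γ t) (γ t + h t)) (x := γ t) (y := γ t + h t)
    (fun y _ => (hg.differentiable (by simp) y).hasFDerivAt.hasFDerivWithinAt)
    (fun y hy => by
      rw [segment_eq_image'] at hy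
      obtain ⟨s, hs, rfl⟩ := hy
      simpa using hseg s hs)
    (convex_segment _ _) (left_mem_segment _ _ _) (right_mem_segment _ _ _)
  simp only [add_sub_cancel_left] at key
  exact key.trans (by gcongr; exact h.norm_coe_le_norm t)

end Superposition

/-- The superposition operator of a `Cⁿ` map is `Cⁿ`. -/
theorem ContDiff.superposition {K : Type*} [TopologicalSpace K] [CompactSpace K]
    {E : Type u} [NormedAddCommGroup E] [NormedSpace ℝ E] (n : ℕ) :
    ∀ {F : Type u} [NormedAddCommGroup F] [NormedSpace ℝ F] {g : E → F} (hg : ContDiff ℝ n g),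
      ContDiff ℝ n (fun γ : C(K, E) => (⟨g, hg.continuous⟩ : C(E, F)).comp γ) := by
  induction n with
  | zero =>
    intro F _ _ g hg
    exact contDiff_zero.2 (ContinuousMap.continuous_postcomp _)
  | succ n ih =>
    intro F _ _ g hg
    have h1 : ContDiff ℝ 1 g := hg.of_le (by norm_cast; omega)
    push_cast
    refine (contDiff_succ_iff_hasFDerivAt).2 ⟨_, ?_, fun γ => h1.hasFDerivAt_superposition γ⟩
    -- The derivative is a continuous linear map applied to the superposition operator of `fderiv ℝ
    -- g`, which is one class lower. Its values lie in `E →L[ℝ] F`, hence the quantification over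
    -- `F` inside the induction.
    exact ContinuousMap.pointwiseApply.contDiff.comp
      (ih (g := fderiv ℝ g) (hg.fderiv_right (by push_cast; rfl)))

/-! ### The integration operator -/

section Volterra

variable {E : Type*} [NormedAddCommGroup E] [NormedSpace ℝ E]

/-- Integration from `0`, on continuous functions on the unit interval. -/
def volterra (E : Type*) [NormedAddCommGroup E] [NormedSpace ℝ E] :
    C(unitInterval, E) →L[ℝ] C(unitInterval, E) :=
  LinearMap.mkContinuous
    { toFun := fun γ => ⟨fun t => ∫ r in (0 : ℝ)..t, IccExtend zero_le_one γ r, by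
        have hc : Continuous (IccExtend zero_le_one γ) := γ.continuous.Icc_extend'
        exact (intervalIntegral.continuous_primitive (fun a b => hc.intervalIntegrable a b) 0).comp
          continuous_subtype_val⟩
      map_add' := by
        intro γ δ
        ext t
        have hc (γ : C(unitInterval, E)) : Continuous (IccExtend zero_le_one γ) :=
          γ.continuous.Icc_extend'
        simp only [ContinuousMap.coe_mk, ContinuousMap.add_apply]
        rw [← intervalIntegral.integral_add ((hc γ).intervalIntegrable _ _)
          ((hc δ).intervalIntegrable _ _)]
        rfl
      map_smul' := by
        intro c γ
        ext t
        simp only [ContinuousMap.coe_mk, ContinuousMap.smul_apply, RingHom.id_apply]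
        rw [← intervalIntegral.integral_smul]
        rfl }
    1 (by
      intro γ
      rw [one_mul, ContinuousMap.norm_le _ (norm_nonneg _)]
      intro t
      refine (intervalIntegral.norm_integral_le_of_norm_le_const (C := ‖γ‖) ?_).trans ?_
      · intro r _
        exact γ.norm_coe_le_norm _
      · rw [sub_zero, abs_of_nonneg t.2.1]
        exact mul_le_of_le_one_right (norm_nonneg _) t.2.2)

theorem volterra_apply (γ : C(unitInterval, E)) (t : unitInterval) :
    volterra E γ t = ∫ r in (0 : ℝ)..t, IccExtend zero_le_one γ r := rfl

theorem norm_volterra_apply_le (γ : C(unitInterval, E)) : ‖volterra E γ‖ ≤ ‖γ‖ := by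
  have := (volterra E).le_of_opNorm_le (LinearMap.mkContinuous_norm_le _ zero_le_one _) γ
  rwa [one_mul] at this

end Volterra

/-! ### Global flows of bounded Lipschitz fields -/

section Flow

open scoped NNReal

/-- A solution of speed at most `C` stays within `C * (n + 1)` of its start up to time `n + 1`.
Picard–Lindelöf therefore applies on every such interval, and uniqueness glues the pieces. -/
theorem exists_global_solution {E : Type*} [NormedAddCommGroup E] [NormedSpace ℝ E]
    [CompleteSpace E] {Y : E → E} {L C : ℝ≥0} (hL : LipschitzWith L Y) (hC : ∀ x, ‖Y x‖ ≤ C)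
    (x : E) : ∃ α : ℝ → E, α 0 = x ∧ ∀ t, HasDerivAt α (Y (α t)) t := by
  have hex : ∀ n : ℕ, ∃ α : ℝ → E, α 0 = x ∧
      ∀ t ∈ Ioo (-((n : ℝ) + 1)) (n + 1), HasDerivAt α (Y (α t)) t := by
    intro n
    have h0 : (0 : ℝ) ∈ Icc (-((n : ℝ) + 1)) (n + 1) := ⟨by linarith [n.cast_nonneg (α := ℝ)],
      by positivity⟩
    have hp : IsPicardLindelof (fun _ => Y) (⟨0, h0⟩ : Icc (-((n : ℝ) + 1)) ((n : ℝ) + 1)) x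
        (C * (n + 1)) 0 C L := by
      refine IsPicardLindelof.of_time_independent (fun x _ => hC x) hL.lipschitzOnWith ?_
      simp
    obtain ⟨α, h1, h2⟩ := hp.exists_eq_forall_mem_Icc_hasDerivWithinAt₀
    exact ⟨α, h1, fun t ht => (h2 t (Ioo_subset_Icc_self ht)).hasDerivAt (Icc_mem_nhds ht.1 ht.2)⟩
  choose α h0 hd using hex
  have hag : ∀ (n m : ℕ) (t : ℝ), |t| < n + 1 → |t| < m + 1 → α n t = α m t := by
    intro n m t hn hm
    have hr : (0 : ℝ) < min ((n : ℝ) + 1) (m + 1) := by positivity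
    refine ODE_solution_unique_of_mem_Ioo (v := fun _ => Y) (s := fun _ => univ) (K := L)
      (t₀ := 0) (a := -(min ((n : ℝ) + 1) (m + 1))) (b := min ((n : ℝ) + 1) (m + 1))
      (fun _ _ => hL.lipschitzOnWith) ⟨by linarith, hr⟩
      (fun s hs => ⟨hd n s ?_, mem_univ _⟩) (fun s hs => ⟨hd m s ?_, mem_univ _⟩)
      ((h0 n).trans (h0 m).symm) (abs_lt.1 (lt_min hn hm))
    · exact ⟨by linarith [hs.1, min_le_left ((n : ℝ) + 1) (m + 1)], hs.2.trans_le (min_le_left _ _)⟩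
    · exact ⟨by linarith [hs.1, min_le_right ((n : ℝ) + 1) (m + 1)],
        hs.2.trans_le (min_le_right _ _)⟩
  -- The half-length of the piece with this index exceeds `|t|` strictly, so near `t` the glued
  -- function coincides with one fixed piece.
  refine ⟨fun t => α ⌈|t|⌉₊ t, by simpa using h0 0, fun t => ?_⟩
  have hlt : ∀ s : ℝ, |s| < (⌈|s|⌉₊ : ℝ) + 1 := fun s => by linarith [Nat.le_ceil |s|]
  have hev : (fun s => α ⌈|s|⌉₊ s) =ᶠ[𝓝 t] α ⌈|t|⌉₊ := by
    have : ∀ᶠ s : ℝ in 𝓝 t, |s| < (⌈|t|⌉₊ : ℝ) + 1 :=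
      continuous_abs.continuousAt.eventually_lt continuousAt_const (hlt t)
    filter_upwards [this] with s hs
    exact hag _ _ s (hlt s) hs
  exact (hd _ t (abs_lt.1 (hlt t))).congr_of_eventuallyEq hev

variable {E : Type u} [NormedAddCommGroup E] [NormedSpace ℝ E] [CompleteSpace E]

/-- A family of solutions of an autonomous Lipschitz equation is `Cⁿ` for small times if the
vector field is `Cⁿ`. -/
theorem contDiffOn_flow_small (n : ℕ) (hn : n ≠ 0) {Y : E → E} (hY : ContDiff ℝ n Y) {L : ℝ≥0}
    (hL : LipschitzWith L Y) {ψ : ℝ × E → E} (h0 : ∀ x, ψ (0, x) = x)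
    (hd : ∀ x t, HasDerivAt (fun t => ψ (t, x)) (Y (ψ (t, x))) t) {δ : ℝ} (hδ : δ * L < 1) :
    ContDiffOn ℝ n ψ ({t | |t| < δ} ×ˢ univ) := by
  have hn1 : (n : ℕ∞ω) ≠ 0 := by exact_mod_cast hn
  have hY1 : ContDiff ℝ 1 Y := hY.of_le (by exact_mod_cast Nat.one_le_iff_ne_zero.2 hn)
  have hψc : ∀ x, Continuous fun t => ψ (t, x) := fun x =>
    continuous_iff_continuousAt.2 fun t => (hd x t).continuousAt
  let Yc : C(E, E) := ⟨Y, hY.continuous⟩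
  -- Rescaling by `p.1` puts all curves on the unit interval and makes time a parameter, so that
  -- regularity in time and in the initial value come out together.
  let c : ℝ × E → C(unitInterval, E) := fun p =>
    ⟨fun t => ψ (p.1 * t, p.2), (hψc p.2).comp (by fun_prop)⟩
  let const : E →L[ℝ] C(unitInterval, E) := ContinuousLinearMap.const ℝ unitInterval
  -- The zeros of `F ((s, x), ·)` are the solutions of the integral equation `γ t = x + s ∫₀ᵗ Y (γ
  -- r) dr`.
  let F : (ℝ × E) × C(unitInterval, E) → C(unitInterval, E) := fun z =>
    z.2 - const z.1.2 - z.1.1 • volterra E (Yc.comp z.2)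
  have hFs : ContDiff ℝ n F := by
    have h1 : ContDiff ℝ n fun γ : C(unitInterval, E) => Yc.comp γ := hY.superposition n
    have h2 : ContDiff ℝ n fun z : (ℝ × E) × C(unitInterval, E) => volterra E (Yc.comp z.2) :=
      (volterra E).contDiff.comp (h1.comp contDiff_snd)
    have h3 : ContDiff ℝ n fun z : (ℝ × E) × C(unitInterval, E) => const z.1.2 :=
      const.contDiff.comp (contDiff_snd.comp contDiff_fst)
    exact (contDiff_snd.sub h3).sub ((contDiff_fst.comp contDiff_fst).smul h2)
  have hFc : ∀ p, F (p, c p) = 0 := by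
    intro p
    ext t
    have hint : ∀ r ∈ uIcc (0 : ℝ) t, IccExtend zero_le_one (Yc.comp (c p)) r =
        Y (ψ (p.1 * r, p.2)) := by
      intro r hr
      rw [uIcc_of_le t.2.1] at hr
      rw [IccExtend_of_mem _ _ ⟨hr.1, hr.2.trans t.2.2⟩]
      rfl
    have hder : ∀ r ∈ uIcc (0 : ℝ) t, HasDerivAt (fun r => ψ (p.1 * r, p.2))
        (p.1 • Y (ψ (p.1 * r, p.2))) r := by
      intro r _
      have := (hd p.2 (p.1 * r)).scomp r ((hasDerivAt_id r).const_mul p.1)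
      simpa [Function.comp_def] using this
    have hft := intervalIntegral.integral_eq_sub_of_hasDerivAt hder
      (Continuous.intervalIntegrable (continuous_const.smul (hY.continuous.comp
        ((hψc p.2).comp (by fun_prop)))) _ _)
    rw [intervalIntegral.integral_smul] at hft
    change ψ (p.1 * t, p.2) - p.2 - p.1 • (volterra E (Yc.comp (c p)) t) = 0
    rw [volterra_apply, intervalIntegral.integral_congr hint, hft]
    simp [h0]
  -- Up to a constant, `F (p, ·)` is the identity minus a contraction of factor at most `δ * L < 1`.
  have huniq : ∀ p : ℝ × E, |p.1| < δ → ∀ γ, F (p, γ) = 0 → γ = c p := by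
    intro p hp γ hγ
    have h1 : γ - c p = p.1 • volterra E (Yc.comp γ - Yc.comp (c p)) := by
      have h2 : F (p, γ) - F (p, c p) = 0 := by rw [hγ, hFc, sub_zero]
      simp only [F] at h2
      rw [map_sub, smul_sub]
      rw [← sub_eq_zero, ← h2]
      abel
    have h3 : ‖Yc.comp γ - Yc.comp (c p)‖ ≤ L * ‖γ - c p‖ := by
      rw [ContinuousMap.norm_le _ (by positivity)]
      intro t
      have := hL.dist_le_mul (γ t) (c p t)
      rw [dist_eq_norm, dist_eq_norm] at this
      exact this.trans (by gcongr; exact (γ - c p).norm_coe_le_norm t)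
    have hδ0 : 0 ≤ δ := (abs_nonneg p.1).trans hp.le
    have h4 : ‖γ - c p‖ ≤ δ * L * ‖γ - c p‖ := by
      calc ‖γ - c p‖ = |p.1| * ‖volterra E (Yc.comp γ - Yc.comp (c p))‖ := by
            rw [← Real.norm_eq_abs, ← norm_smul, ← h1]
        _ ≤ δ * (L * ‖γ - c p‖) := by
            gcongr
            exact (norm_volterra_apply_le _).trans h3
        _ = _ := by ring
    have h5 : ‖γ - c p‖ = 0 := by nlinarith [norm_nonneg (γ - c p)]
    exact sub_eq_zero.1 (norm_eq_zero.1 h5)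
  have hopen : IsOpen {t : ℝ | |t| < δ} := isOpen_lt continuous_abs continuous_const
  rintro ⟨s, x⟩ ⟨hs, -⟩
  have hs : |s| < δ := hs
  apply ContDiffAt.contDiffWithinAt
  have hcd : ContDiffAt ℝ n F ((s, x), c (s, x)) := hFs.contDiffAt
  have hfd : HasFDerivAt F (fderiv ℝ F ((s, x), c (s, x))) ((s, x), c (s, x)) :=
    (hFs.differentiable hn1 _).hasFDerivAt
  let A : C(unitInterval, E) →L[ℝ] C(unitInterval, E) :=
    s • (volterra E).comp (ContinuousMap.pointwiseApply
      ((⟨fderiv ℝ Y, hY1.continuous_fderiv (by simp)⟩ : C(E, E →L[ℝ] E)).comp (c (s, x))))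
  have hpart : fderiv ℝ F ((s, x), c (s, x)) ∘L .inr ℝ (ℝ × E) C(unitInterval, E) = 1 - A := by
    have h1 : HasFDerivAt (fun γ => F ((s, x), γ)) (1 - A) (c (s, x)) := by
      have h2 := (volterra E).hasFDerivAt.comp (c (s, x)) (hY1.hasFDerivAt_superposition (c (s, x)))
      exact ((hasFDerivAt_id (𝕜 := ℝ) (c (s, x))).sub_const (const x)).sub (h2.const_smul s)
    have h3 := hfd.comp (c (s, x)) (hasFDerivAt_prodMk_right (𝕜 := ℝ) (s, x) (c (s, x)))
    exact h3.unique h1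
  -- The contraction estimate again, now for the derivative; the Neumann series then inverts `1 -
  -- A`.
  have hA : ‖A‖ < 1 := by
    refine lt_of_le_of_lt (ContinuousLinearMap.opNorm_le_bound _ (by positivity) fun γ => ?_)
      (show |s| * L < 1 from lt_of_le_of_lt (by gcongr) hδ)
    change ‖s • volterra E (ContinuousMap.pointwiseApply _ γ)‖ ≤ _
    rw [norm_smul, mul_assoc, Real.norm_eq_abs]
    gcongr
    refine (norm_volterra_apply_le _).trans ?_
    rw [ContinuousMap.norm_le _ (by positivity)]
    intro t
    refine ((fderiv ℝ Y (c (s, x) t)).le_opNorm (γ t)).trans ?_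
    gcongr
    · exact norm_fderiv_le_of_lipschitz ℝ hL
    · exact γ.norm_coe_le_norm t
  have hinv : (fderiv ℝ F ((s, x), c (s, x)) ∘L .inr ℝ (ℝ × E) C(unitInterval, E)).IsInvertible := by
    rw [hpart]
    exact ⟨ContinuousLinearEquiv.unitsEquiv ℝ _ (Units.oneSub A hA), rfl⟩
  have hg := hcd.contDiffAt_implicitFunction hn1 hinv
  have hev := hcd.eventually_apply_implicitFunction hn1 hinv
  -- The implicit function is a `Cⁿ` family of zeros. Uniqueness of zeros identifies it with the
  -- rescaled solution curves, and evaluation at `1` recovers `ψ`.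
  have heq : c =ᶠ[𝓝 (s, x)] hcd.implicitFunction hn1 hinv := by
    filter_upwards [hev, (continuous_fst.isOpen_preimage _ hopen).mem_nhds hs] with p hp hp'
    rw [hFc] at hp
    exact (huniq p hp' _ hp).symm
  have hc : ContDiffAt ℝ n c (s, x) := hg.congr_of_eventuallyEq heq
  have hev1 : ContDiffAt ℝ n (fun p => ContinuousMap.evalCLM ℝ (1 : unitInterval) (c p)) (s, x) :=
    (ContinuousMap.evalCLM (M := E) ℝ (1 : unitInterval)).contDiff.contDiffAt.comp (s, x) hc
  refine hev1.congr_of_eventuallyEq (Eventually.of_forall fun p => ?_)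
  change ψ p = ψ (p.1 * ((1 : unitInterval) : ℝ), p.2)
  simp

/-- A bounded Lipschitz vector field of class `Cⁿ` has a global flow, of class `Cⁿ` jointly in
time and initial value. -/
theorem exists_contDiff_flow (n : ℕ) (hn : n ≠ 0) {Y : E → E} (hY : ContDiff ℝ n Y) {L C : ℝ≥0}
    (hL : LipschitzWith L Y) (hC : ∀ x, ‖Y x‖ ≤ C) :
    ∃ ψ : ℝ × E → E, ContDiff ℝ n ψ ∧ (∀ x, ψ (0, x) = x) ∧
      ∀ x t, HasDerivAt (fun t => ψ (t, x)) (Y (ψ (t, x))) t := by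
  choose α h0 hd using exists_global_solution hL hC
  let ψ : ℝ × E → E := fun p => α p.2 p.1
  have hadd : ∀ s t x, ψ (t + s, x) = ψ (t, ψ (s, x)) := by
    intro s t x
    have := ODE_solution_unique_univ (v := fun _ => Y) (s := fun _ => univ) (K := L) (t₀ := 0)
      (f := fun t => ψ (t + s, x)) (g := fun t => ψ (t, ψ (s, x)))
      (fun _ => hL.lipschitzOnWith)
      (fun t => ⟨(hd x (t + s)).comp_add_const t s, mem_univ _⟩)
      (fun t => ⟨hd _ t, mem_univ _⟩) (by simp [ψ, h0])
    exact congrFun this t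
  refine ⟨ψ, ?_, h0, hd⟩
  set δ : ℝ := 1 / (L + 1) with hδdef
  have hL0 : (0 : ℝ) < L + 1 := by positivity
  have hδ0 : 0 < δ := by positivity
  have hδ : δ * L < 1 := by
    rw [hδdef, one_div, inv_mul_lt_iff₀ hL0]
    linarith
  have hsmall := contDiffOn_flow_small n hn hY hL (ψ := ψ) h0 hd hδ
  -- By the group law, long times are reached in `k` equal steps shorter than `δ`.
  have hbig : ∀ k : ℕ, ContDiffOn ℝ n (fun p : ℝ × E => ψ (k * p.1, p.2))
      ({t | |t| < δ} ×ˢ univ) := by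
    intro k
    induction k with
    | zero => simpa [ψ, h0] using contDiffOn_snd
    | succ k ih =>
      have h1 : ∀ p : ℝ × E, ψ (((k + 1 : ℕ) : ℝ) * p.1, p.2) = ψ (p.1, ψ (k * p.1, p.2)) := by
        intro p
        rw [← hadd]
        congr 2
        push_cast
        ring
      simp_rw [h1]
      exact hsmall.comp (contDiffOn_fst.prodMk ih) fun p hp => ⟨hp.1, mem_univ _⟩
  rw [contDiff_iff_contDiffAt]
  rintro ⟨t, x⟩
  obtain ⟨k, hk⟩ := exists_nat_gt (|t| / δ)
  have hk0 : (0 : ℝ) < k := lt_of_le_of_lt (by positivity) hk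
  have hopen : IsOpen ({t : ℝ | |t| < δ} ×ˢ (univ : Set E)) :=
    (isOpen_lt continuous_abs continuous_const).prod isOpen_univ
  have hmem : ((t / k, x) : ℝ × E) ∈ {t : ℝ | |t| < δ} ×ˢ (univ : Set E) := by
    refine ⟨?_, mem_univ _⟩
    change |t / k| < δ
    rw [abs_div, abs_of_pos hk0, div_lt_iff₀ hk0]
    rwa [div_lt_iff₀ hδ0, mul_comm] at hk
  have h2 : ContDiffAt ℝ n (fun p : ℝ × E => ψ (k * (p.1 / k), p.2)) (t, x) :=
    ((hbig k).contDiffAt (hopen.mem_nhds hmem)).comp (t, x)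
      (f := fun p : ℝ × E => (p.1 / k, p.2)) (by fun_prop)
  refine h2.congr_of_eventuallyEq (Eventually.of_forall fun p => ?_)
  change ψ p = ψ (k * (p.1 / k), p.2)
  rw [mul_div_cancel₀ _ hk0.ne']

end Flow

/-! ### Truncation of vector fields -/

section Cutoff

variable {E : Type*} [NormedAddCommGroup E] [NormedSpace ℝ E] [FiniteDimensional ℝ E]
  {F : Type*} [NormedAddCommGroup F] [NormedSpace ℝ F]

/-- A map of class `Cⁿ` on an open set agrees, near a compact subset, with a compactly supported
map of class `Cⁿ` on the whole space. -/
theorem ContDiffOn.exists_hasCompactSupport_eqOn {n : ℕ} {Y : E → F} {O K : Set E} (hO : IsOpen O)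
    (hK : IsCompact K) (hKO : K ⊆ O) (hY : ContDiffOn ℝ n Y O) :
    ∃ (Z : E → F) (U : Set E), ContDiff ℝ n Z ∧ HasCompactSupport Z ∧ IsOpen U ∧ K ⊆ U ∧ U ⊆ O ∧
      EqOn Z Y U := by
  obtain ⟨K', hK', hKK', hK'O⟩ := exists_compact_between hK hO hKO
  obtain ⟨f, hf1, hf0, -⟩ := exists_contMDiffMap_one_nhds_of_subset_interior
    (n := (n : ℕ∞)) (modelWithCornersSelf ℝ E) hK.isClosed hKK'
  have hf : ContDiff ℝ n f := contMDiff_iff_contDiff.1 f.contMDiff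
  have hsupp : tsupport f ⊆ K' := closure_minimal (fun x hx => by
    by_contra h
    exact hx (hf0 x h)) hK'.isClosed
  have hev : ∀ x ∈ K, ∀ᶠ y in 𝓝 x, f y = 1 := fun x hx => hf1.filter_mono (nhds_le_nhdsSet hx)
  refine ⟨fun x => f x • Y x, {x | ∀ᶠ y in 𝓝 x, f y = 1} ∩ O, ?_, ?_, ?_, ?_, ?_, ?_⟩
  · rw [contDiff_iff_contDiffAt]
    intro x
    by_cases hx : x ∈ O
    · exact hf.contDiffAt.smul (hY.contDiffAt (hO.mem_nhds hx))
    -- A point outside `O` has a neighbourhood disjoint from the support of `f`, so the behaviour of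
    -- `Y` there is irrelevant.
    · have : (fun x => f x • Y x) =ᶠ[𝓝 x] fun _ => 0 := by
        filter_upwards [(isClosed_tsupport f).isOpen_compl.mem_nhds
          (fun h => hx (hK'O (hsupp h)))] with y hy
        rw [image_eq_zero_of_notMem_tsupport hy, zero_smul]
      exact contDiffAt_const.congr_of_eventuallyEq this
  · exact HasCompactSupport.intro hK' fun x hx => by rw [hf0 x hx, zero_smul]
  · exact isOpen_setOfPred_eventually_nhds.inter hO
  · exact fun x hx => ⟨hev x hx, hKO hx⟩
  · exact inter_subset_right
  · intro x hx
    simp [hx.1.self_of_nhds]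

end Cutoff

/-! ### Flows near a given solution and hitting times -/

theorem HasDerivWithinAt.Ici_of_Icc {E : Type*} [NormedAddCommGroup E] [NormedSpace ℝ E]
    {f : ℝ → E} {f' : E} {a b t : ℝ} (ht : t ∈ Ico a b)
    (h : HasDerivWithinAt f f' (Icc a b) t) : HasDerivWithinAt f f' (Ici t) t :=
  h.mono_of_mem_nhdsWithin (Icc_mem_nhdsGE_of_mem ht)

section LocalFlow

open scoped NNReal

variable {E : Type u} [NormedAddCommGroup E] [NormedSpace ℝ E] [FiniteDimensional ℝ E]

/-- Two solutions, within an open set on which the vector field is `C¹`, with the same initial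
value coincide. -/
theorem solution_unique_of_contDiffOn {Y : E → E} {O : Set E} (hO : IsOpen O)
    (hY : ContDiffOn ℝ 1 Y O) {T : ℝ} {γ₁ γ₂ : ℝ → E} (h0 : γ₁ 0 = γ₂ 0)
    (h1 : ∀ t ∈ Icc 0 T, γ₁ t ∈ O ∧ HasDerivWithinAt γ₁ (Y (γ₁ t)) (Icc 0 T) t)
    (h2 : ∀ t ∈ Icc 0 T, γ₂ t ∈ O ∧ HasDerivWithinAt γ₂ (Y (γ₂ t)) (Icc 0 T) t) :
    EqOn γ₁ γ₂ (Icc 0 T) := by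
  have c1 : ContinuousOn γ₁ (Icc 0 T) := fun t ht => (h1 t ht).2.continuousWithinAt
  have c2 : ContinuousOn γ₂ (Icc 0 T) := fun t ht => (h2 t ht).2.continuousWithinAt
  -- Both curves have compact images in `O`, so near them the field may be replaced by a compactly
  -- supported one, which is globally Lipschitz.
  obtain ⟨Z, U, hZ, hZc, -, hKU, -, hZY⟩ := ContDiffOn.exists_hasCompactSupport_eqOn (n := 1) hO
    ((isCompact_Icc.image_of_continuousOn c1).union (isCompact_Icc.image_of_continuousOn c2))
    (union_subset (image_subset_iff.2 fun t ht => (h1 t ht).1)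
      (image_subset_iff.2 fun t ht => (h2 t ht).1)) (by exact_mod_cast hY)
  obtain ⟨L, hL⟩ := hZ.lipschitzWith_of_hasCompactSupport hZc (by simp)
  refine ODE_solution_unique (v := fun _ => Z) (fun _ => hL) c1 (fun t ht => ?_) c2
    (fun t ht => ?_) h0
  · rw [hZY (hKU (Or.inl (mem_image_of_mem _ (Ico_subset_Icc_self ht))))]
    exact ((h1 t (Ico_subset_Icc_self ht)).2).Ici_of_Icc ht
  · rw [hZY (hKU (Or.inr (mem_image_of_mem _ (Ico_subset_Icc_self ht))))]
    exact ((h2 t (Ico_subset_Icc_self ht)).2).Ici_of_Icc ht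

/-- The flow near a given solution, of class `Cⁿ` in time and initial value. -/
theorem exists_flow_near_solution (n : ℕ) (hn : n ≠ 0) {Y : E → E} {O : Set E} (hO : IsOpen O)
    (hY : ContDiffOn ℝ n Y O) {θ : ℝ} (hθ : 0 ≤ θ) {γ : ℝ → E}
    (hγ : ∀ t ∈ Icc 0 θ, γ t ∈ O ∧ HasDerivWithinAt γ (Y (γ t)) (Icc 0 θ) t) :
    ∃ (φ : ℝ × E → E) (ε : ℝ), 0 < ε ∧ ContDiff ℝ n φ ∧ (∀ z, φ (0, z) = z) ∧
      (∀ t ∈ Icc 0 θ, φ (t, γ 0) = γ t) ∧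
      ∀ᶠ z in 𝓝 (γ 0), ∀ t ∈ Icc 0 (θ + ε), φ (t, z) ∈ O ∧
        HasDerivAt (fun t => φ (t, z)) (Y (φ (t, z))) t := by
  have hc : ContinuousOn γ (Icc 0 θ) := fun t ht => (hγ t ht).2.continuousWithinAt
  obtain ⟨Z, U, hZ, hZc, hU, hKU, hUO, hZY⟩ := ContDiffOn.exists_hasCompactSupport_eqOn hO
    (isCompact_Icc.image_of_continuousOn hc) (image_subset_iff.2 fun t ht => (hγ t ht).1) hY
  have hn1 : (n : ℕ∞ω) ≠ 0 := by exact_mod_cast hn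
  obtain ⟨L, hL⟩ := hZ.lipschitzWith_of_hasCompactSupport hZc hn1
  obtain ⟨C, hC⟩ := hZ.continuous.bounded_above_of_compact_support hZc
  obtain ⟨φ, hφ, hφ0, hφd⟩ := exists_contDiff_flow n hn hZ hL (C := C.toNNReal)
    (fun x => (hC x).trans (Real.le_coe_toNNReal C))
  have hφγ : ∀ t ∈ Icc 0 θ, φ (t, γ 0) = γ t := by
    refine ODE_solution_unique (v := fun _ => Z) (fun _ => hL)
      (fun t _ => (hφd (γ 0) t).continuousAt.continuousWithinAt)
      (fun t _ => (hφd (γ 0) t).hasDerivWithinAt) hc (fun t ht => ?_) (hφ0 _)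
    rw [hZY (hKU (mem_image_of_mem _ (Ico_subset_Icc_self ht)))]
    exact ((hγ t (Ico_subset_Icc_self ht)).2).Ici_of_Icc ht
  -- A solution of the truncated equation solves the original one while it stays in `U`. By
  -- compactness of the time interval this persists for nearby initial values and for times slightly
  -- beyond `θ`.
  obtain ⟨u, v, hu, hv, hIu, h0v, huv⟩ := generalized_tube_lemma (isCompact_Icc (a := 0) (b := θ))
    (isCompact_singleton (x := γ 0)) (hU.preimage hφ.continuous) (by
      rintro ⟨t, z⟩ ⟨ht, hz⟩
      obtain rfl : z = γ 0 := hz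
      change φ (t, γ 0) ∈ U
      rw [hφγ t ht]
      exact hKU (mem_image_of_mem _ ht))
  obtain ⟨ε, hε, hεu⟩ := Metric.isOpen_iff.1 hu θ (hIu ⟨hθ, le_rfl⟩)
  refine ⟨φ, ε / 2, by positivity, hφ, hφ0, hφγ, ?_⟩
  filter_upwards [hv.mem_nhds (h0v rfl)] with z hz t ht
  have htu : t ∈ u := by
    rcases le_or_gt t θ with h | h
    · exact hIu ⟨ht.1, h⟩
    · refine hεu ?_
      rw [Metric.mem_ball, Real.dist_eq, abs_of_pos (by linarith)]
      linarith [ht.2]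
  have hmem : φ (t, z) ∈ U := huv (mk_mem_prod htu hz)
  refine ⟨hUO hmem, ?_⟩
  rw [← hZY hmem]
  exact hφd z t

/-- Transversal crossings of a hypersurface persist, at a time of class `Cⁿ`. -/
theorem exists_hitting_time {n : ℕ∞ω} (hn : n ≠ 0) {φ : ℝ × E → E} {h : E → ℝ} {θ d : ℝ} {z₀ : E}
    (hφ : ContDiffAt ℝ n φ (θ, z₀)) (hh : ContDiffAt ℝ n h (φ (θ, z₀))) (h0 : h (φ (θ, z₀)) = 0)
    (hd : HasDerivAt (fun t => h (φ (t, z₀))) d θ) (hd0 : d ≠ 0) :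
    ∃ τ : E → ℝ, ContDiffAt ℝ n τ z₀ ∧ τ z₀ = θ ∧
      ∀ᶠ p in 𝓝 (z₀, θ), h (φ (p.2, p.1)) = 0 ↔ τ p.1 = p.2 := by
  let F : E × ℝ → ℝ := fun p => h (φ (p.2, p.1))
  have hF : ContDiffAt ℝ n F (z₀, θ) :=
    ContDiffAt.comp (z₀, θ) (f := fun p : E × ℝ => φ (p.2, p.1)) hh
      (ContDiffAt.comp (z₀, θ) (f := fun p : E × ℝ => (p.2, p.1)) hφ (by fun_prop))
  have hpart : fderiv ℝ F (z₀, θ) ∘L .inr ℝ E ℝ = ContinuousLinearMap.toSpanSingleton ℝ d := by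
    have h1 := (hF.differentiableAt hn).hasFDerivAt.comp θ
      (hasFDerivAt_prodMk_right (𝕜 := ℝ) z₀ θ)
    exact h1.unique hd.hasFDerivAt
  have hinv : (fderiv ℝ F (z₀, θ) ∘L .inr ℝ E ℝ).IsInvertible := by
    rw [hpart]
    refine ⟨ContinuousLinearEquiv.unitsEquivAut ℝ (Units.mk0 d hd0), ?_⟩
    ext
    simp
  refine ⟨hF.implicitFunction hn hinv, hF.contDiffAt_implicitFunction hn hinv,
    hF.implicitFunction_apply_self hn hinv, ?_⟩
  -- The equivalence also excludes any other crossing near `θ`; this is needed to recognize the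
  -- first hitting time.
  have := hF.eventually_apply_eq_iff_implicitFunction hn hinv
  simpa only [F, h0] using this

end LocalFlow

/-! ### Tangent cones of level sets -/

section TangentCone

variable {E F : Type*} [NormedAddCommGroup E] [NormedSpace ℝ E] [NormedAddCommGroup F]
  [NormedSpace ℝ F]

/-- The kernel of the derivative of a submersion consists of tangent vectors of the level set. -/
theorem HasStrictFDerivAt.ker_subset_tangentConeAt [CompleteSpace E] [FiniteDimensional ℝ F]
    {G : E → F} {G' : E →L[ℝ] F} {x : E}
    (hG : HasStrictFDerivAt G G' x) (hsurj : G'.range = ⊤) {v : E} (hv : G' v = 0) :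
    v ∈ tangentConeAt ℝ {y | G y = G x} x := by
  have : CompleteSpace F := FiniteDimensional.complete ℝ F
  let w : G'.ker := ⟨v, hv⟩
  -- The implicit function parametrizes the level set by the kernel; along the line spanned by `v`
  -- it gives a curve in the level set with velocity `v`.
  let c : ℝ → E := fun s => hG.implicitFunction G G' hsurj (G x) (s • w)
  have hc0 : c 0 = x := by
    simp [c]
  have hcd : HasDerivAt c v 0 := by
    have h1 : HasFDerivAt (hG.implicitFunction G G' hsurj (G x)) G'.ker.subtypeL ((0 : ℝ) • w) := by
      rw [zero_smul]
      exact (hG.to_implicitFunction hsurj).hasFDerivAt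
    have h2 : HasDerivAt c _ 0 :=
      h1.comp_hasDerivAt (0 : ℝ) ((hasDerivAt_id (0 : ℝ)).smul_const w)
    simpa [w] using h2
  have hmem : ∀ᶠ s in 𝓝 (0 : ℝ), G (c s) = G x := by
    have h1 := hG.map_implicitFunction_eq hsurj
    have h2 : Tendsto (fun s : ℝ => (G x, s • w)) (𝓝 0) (𝓝 (G x, (0 : G'.ker))) := by
      have : Continuous fun s : ℝ => (G x, s • w) := by fun_prop
      simpa using this.tendsto 0
    exact h2.eventually h1
  refine mem_tangentConeAt_of_seq (𝓝[≠] (0 : ℝ)) (fun s => s⁻¹) (fun s => c s - x) ?_ ?_ ?_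
  · have := hcd.continuousAt.tendsto.sub_const x
    rw [hc0, sub_self] at this
    exact this.mono_left nhdsWithin_le_nhds
  · filter_upwards [nhdsWithin_le_nhds hmem] with s hs
    simpa using hs
  · have := hasDerivAt_iff_tendsto_slope_zero.1 hcd
    simpa [hc0] using this

/-- A tangent vector of a set on which a map is constant is in the kernel of its derivative. -/
theorem HasFDerivAt.eq_zero_of_mem_tangentConeAt {G : E → F} {G' : E →L[ℝ] F} {x : E} {s : Set E}
    (hG : HasFDerivAt G G' x) (hs : ∀ y ∈ s, G y = G x) {v : E} (hv : v ∈ tangentConeAt ℝ s x) :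
    G' v = 0 := by
  -- Zero is also a derivative within `s`, and two derivatives within `s` agree on its tangent
  -- vectors.
  have h1 : HasFDerivWithinAt G (0 : E →L[ℝ] F) s x :=
    (hasFDerivWithinAt_const (G x) x s).congr hs rfl
  exact hG.hasFDerivWithinAt.unique_on h1 hv

end TangentCone

/-! ### Gluing of local selections -/

/-- Local `C¹` selections of a family of convex sets can be glued to a differentiable selection. -/
theorem exists_differentiableOn_forall_mem_convex {P F : Type*} [NormedAddCommGroup P]
    [NormedSpace ℝ P] [FiniteDimensional ℝ P] [NormedAddCommGroup F] [NormedSpace ℝ F]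
    {S : Set P} {t : P → Set F} (ht : ∀ ξ, Convex ℝ (t ξ))
    (hloc : ∀ ξ₀ ∈ S, ∃ g : P → F, ContDiffAt ℝ 1 g ξ₀ ∧ ∀ᶠ ξ in 𝓝 ξ₀, ξ ∈ S → g ξ ∈ t ξ) :
    ∃ Ψ : P → F, DifferentiableOn ℝ Ψ S ∧ ∀ ξ ∈ S, Ψ ξ ∈ t ξ := by
  classical
  choose! g hg hgt using hloc
  have hU : ∀ ξ₀ ∈ S, ∃ U, IsOpen U ∧ ξ₀ ∈ U ∧ ContDiffOn ℝ 1 (g ξ₀) U ∧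
      ∀ ξ ∈ U, ξ ∈ S → g ξ₀ ξ ∈ t ξ := by
    intro ξ₀ hξ₀
    obtain ⟨u, hu, hgu⟩ := (hg ξ₀ hξ₀).contDiffOn (m := 1) le_rfl (by simp)
    obtain ⟨U, hUs, hUo, hU0⟩ := mem_nhds_iff.1 (inter_mem hu (hgt ξ₀ hξ₀))
    exact ⟨U, hUo, hU0, hgu.mono fun x hx => (hUs hx).1, fun ξ hξ => (hUs hξ).2⟩
  choose! U hUo hU0 hgU hUt using hU
  -- Since `S` need not be open, the partition of unity lives on an open neighbourhood of `S`, and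
  -- nothing is required of the selection at points outside `S`.
  let O : TopologicalSpace.Opens P := ⟨⋃ ξ₀ ∈ S, U ξ₀, isOpen_biUnion hUo⟩
  have : LocallyCompactSpace O := O.isOpen.locallyCompactSpace
  obtain ⟨Ψ, hΨ⟩ := exists_contMDiffMap_forall_mem_convex_of_local (n := 1)
    (modelWithCornersSelf ℝ P) (M := O) (F := F)
    (t := fun ξ => {y | (ξ : P) ∈ S → y ∈ t ξ})
    (fun ξ a ha b hb r s hr hs hrs hξ => ht ξ (ha hξ) (hb hξ) hr hs hrs)
    (by
      rintro ⟨ξ, hξ⟩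
      obtain ⟨ξ₀, hξ₀, hξU⟩ := mem_iUnion₂.1 hξ
      refine ⟨Subtype.val ⁻¹' (U ξ₀), ((hUo ξ₀ hξ₀).preimage continuous_subtype_val).mem_nhds hξU,
        fun ξ => g ξ₀ ξ, ?_, fun y hy hyS => hUt ξ₀ hξ₀ y hy hyS⟩
      intro y hy
      apply ContMDiffAt.contMDiffWithinAt
      rw [contMDiffAt_subtype_iff (f := g ξ₀)]
      exact ((hgU ξ₀ hξ₀).contDiffAt ((hUo ξ₀ hξ₀).mem_nhds hy)).contMDiffAt)
  have hSO : ∀ ξ ∈ S, ξ ∈ O := fun ξ hξ => mem_iUnion₂.2 ⟨ξ, hξ, hU0 ξ hξ⟩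
  refine ⟨fun ξ => if h : ξ ∈ O then Ψ ⟨ξ, h⟩ else 0, fun ξ hξ => ?_, fun ξ hξ => ?_⟩
  · apply DifferentiableAt.differentiableWithinAt
    have h1 := Ψ.contMDiff ⟨ξ, hSO ξ hξ⟩
    have h2 : (Ψ : O → F) = fun x : O => (fun ξ => if h : ξ ∈ O then Ψ ⟨ξ, h⟩ else 0) (x : P) := by
      funext x
      simp
    rw [h2] at h1
    have h3 := (contMDiffAt_subtype_iff (f := fun ξ => if h : ξ ∈ O then Ψ ⟨ξ, h⟩ else 0)).1 h1
    exact (contMDiffAt_iff_contDiffAt.1 h3).differentiableAt (by simp)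
  · simp only [hSO ξ hξ, dite_true]
    exact hΨ ⟨ξ, hSO ξ hξ⟩ hξ

/-! ### Smoothness of matrix expressions and partial derivatives -/

section MatrixSmooth

variable {E : Type*} [NormedAddCommGroup E] [NormedSpace ℝ E] {ι κ ν : Type*} {n : ℕ∞ω}
  {O : Set E}

theorem ContDiffOn.matrix_mul [Fintype κ] {A : E → Matrix ι κ ℝ} {B : E → Matrix κ ν ℝ}
    (hA : ∀ i j, ContDiffOn ℝ n (fun z => A z i j) O)
    (hB : ∀ i j, ContDiffOn ℝ n (fun z => B z i j) O) (i : ι) (j : ν) :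
    ContDiffOn ℝ n (fun z => (A z * B z) i j) O := by
  simp only [Matrix.mul_apply]
  exact ContDiffOn.sum fun k _ => (hA i k).mul (hB k j)

theorem ContDiffOn.matrix_mulVec [Fintype κ] {A : E → Matrix ι κ ℝ} {v : E → κ → ℝ}
    (hA : ∀ i j, ContDiffOn ℝ n (fun z => A z i j) O)
    (hv : ∀ j, ContDiffOn ℝ n (fun z => v z j) O) (i : ι) :
    ContDiffOn ℝ n (fun z => (A z *ᵥ v z) i) O := by
  simp only [Matrix.mulVec, dotProduct]
  exact ContDiffOn.sum fun k _ => (hA i k).mul (hv k)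

theorem ContDiffOn.matrix_det [Fintype ι] [DecidableEq ι] {A : E → Matrix ι ι ℝ}
    (hA : ∀ i j, ContDiffOn ℝ n (fun z => A z i j) O) :
    ContDiffOn ℝ n (fun z => (A z).det) O := by
  simp only [Matrix.det_apply']
  exact ContDiffOn.sum fun σ _ => contDiffOn_const.mul (contDiffOn_prod fun i _ => hA _ i)

/-- Cramer's rule. -/
theorem ContDiffOn.matrix_inv [Fintype ι] [DecidableEq ι] {A : E → Matrix ι ι ℝ}
    (hA : ∀ i j, ContDiffOn ℝ n (fun z => A z i j) O) (h0 : ∀ z ∈ O, (A z).det ≠ 0) (i j : ι) :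
    ContDiffOn ℝ n (fun z => (A z)⁻¹ i j) O := by
  simp only [Matrix.inv_def, Ring.inverse_eq_inv', Matrix.smul_apply, smul_eq_mul,
    Matrix.adjugate_apply]
  refine ((ContDiffOn.matrix_det hA).inv h0).mul (ContDiffOn.matrix_det fun k l => ?_)
  simp only [Matrix.updateRow_apply]
  split_ifs
  · exact contDiffOn_const
  · exact hA k l

/-- The derivative with the parameter frozen is the full derivative in the direction `(v z, 0)`.
Iteration gives joint smoothness, in state and parameters, of repeated Lie derivatives of the
outputs. -/
theorem ContDiffOn.fderiv_partial {P G : Type*} [NormedAddCommGroup P] [NormedSpace ℝ P]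
    [NormedAddCommGroup G] [NormedSpace ℝ G] {O : Set (E × P)} (hO : IsOpen O) {F : E × P → G}
    (hF : ContDiffOn ℝ ∞ F O) {v : E × P → E} (hv : ContDiffOn ℝ ∞ v O) :
    ContDiffOn ℝ ∞ (fun z => fderiv ℝ (fun x => F (x, z.2)) z.1 (v z)) O := by
  have h1 : ContDiffOn ℝ ∞ (fun z => fderiv ℝ F z (v z, 0)) O :=
    (hF.fderiv_of_isOpen hO (m := ∞) (by simp)).clm_apply (hv.prodMk contDiffOn_const)
  refine h1.congr fun z hz => ?_
  have h2 : HasFDerivAt F (fderiv ℝ F (z.1, z.2)) (z.1, z.2) :=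
    ((hF.contDiffAt (hO.mem_nhds hz)).differentiableAt (by simp)).hasFDerivAt
  have h3 := h2.comp z.1 (hasFDerivAt_prodMk_left (𝕜 := ℝ) z.1 z.2)
  change fderiv ℝ (F ∘ fun x => (x, z.2)) z.1 (v z) = _
  rw [h3.fderiv]
  simp

theorem ContDiffOn.fderiv_apply_const {G : Type*} [NormedAddCommGroup G] [NormedSpace ℝ G]
    (hO : IsOpen O) {F : E → G} (hF : ContDiffOn ℝ ∞ F O) (v : E) :
    ContDiffOn ℝ ∞ (fun z => fderiv ℝ F z v) O :=
  (hF.fderiv_of_isOpen hO (m := ∞) (by simp)).clm_apply contDiffOn_const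

end MatrixSmooth

/-! ### Smoothness of the constrained dynamics and of the resets -/

namespace Robot

variable {nq m : ℕ} {Con : Type*} (R : Robot nq m Con)

theorem det_D_ne_zero {q : Vec nq} (hq : q ∈ R.Q) : (R.D q).det ≠ 0 :=
  (R.posDef_D q hq).det_pos.ne'

theorem contDiffOn_inv_D (i j : Fin nq) : ContDiffOn ℝ ∞ (fun q => (R.D q)⁻¹ i j) R.Q :=
  ContDiffOn.matrix_inv R.smooth_D (fun _ hq => R.det_D_ne_zero hq) i j

theorem contDiffOn_drift (i : Fin nq) :
    ContDiffOn ℝ ∞ (fun x : State nq => R.drift x.1 x.2 i) {x | x.1 ∈ R.Q} := by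
  have hfst : MapsTo (Prod.fst : State nq → Vec nq) {x | x.1 ∈ R.Q} R.Q := fun x hx => hx
  have hdD : ∀ k i j, ContDiffOn ℝ ∞ (fun x : State nq => R.dD x.1 k i j) {x | x.1 ∈ R.Q} :=
    fun k i j => ((R.smooth_D i j).fderiv_apply_const R.isOpen_Q _).comp contDiffOn_fst hfst
  have hdq : ∀ k, ContDiffOn ℝ ∞ (fun x : State nq => x.2 k) {x | x.1 ∈ R.Q} := fun k => by
    fun_prop
  have hC : ∀ i j, ContDiffOn ℝ ∞ (fun x : State nq => R.coriolis x.1 x.2 i j) {x | x.1 ∈ R.Q} := by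
    intro i j
    simp only [coriolis, Matrix.of_apply]
    exact ContDiffOn.sum fun k _ => (contDiffOn_const.mul
      (((hdD k i j).add (hdD j i k)).sub (hdD i k j))).mul (hdq k)
  have hG : ContDiffOn ℝ ∞ (fun x : State nq => R.gravity x.1 i) {x | x.1 ∈ R.Q} :=
    (R.smooth_pot.fderiv_apply_const R.isOpen_Q _).comp contDiffOn_fst hfst
  exact (ContDiffOn.matrix_mulVec hC hdq i).add hG


theorem isOpen_fst_mem_Q : IsOpen {x : State nq | x.1 ∈ R.Q} :=
  R.isOpen_Q.preimage continuous_fst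

variable (K : Finset Con)

theorem contDiffOn_jac (c : K) (j : Fin nq) : ContDiffOn ℝ ∞ (fun q => R.jac K q c j) R.Q :=
  (R.smooth_η c).fderiv_apply_const R.isOpen_Q _

theorem contDiffOn_jac_mulVec (c : K) :
    ContDiffOn ℝ ∞ (fun x : State nq => (R.jac K x.1 *ᵥ x.2) c) {x | x.1 ∈ R.Q} :=
  ContDiffOn.matrix_mulVec
    (fun i j => (R.contDiffOn_jac K i j).comp contDiffOn_fst fun _ hx => hx)
    (fun _ => by fun_prop) c

theorem contDiffOn_jacDot (c : K) :
    ContDiffOn ℝ ∞ (fun x : State nq => R.jacDot K x.1 x.2 c) {x | x.1 ∈ R.Q} :=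
  (R.contDiffOn_jac_mulVec K c).fderiv_partial R.isOpen_fst_mem_Q contDiffOn_snd

theorem contDiffOn_contactInertia (c c' : K) :
    ContDiffOn ℝ ∞ (fun q => R.contactInertia K q c c') R.Q :=
  ContDiffOn.matrix_mul (ContDiffOn.matrix_mul (R.contDiffOn_jac K) R.contDiffOn_inv_D)
    (fun i j => R.contDiffOn_jac K j i) c c'

variable [DecidableEq Con]

/-- The configurations at which the contact constraints in `K` are independent. -/
def regular : Set (Vec nq) := {q | q ∈ R.Q ∧ (R.contactInertia K q).det ≠ 0}

theorem isOpen_regular : IsOpen (R.regular K) :=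
  (ContDiffOn.matrix_det (R.contDiffOn_contactInertia K)).continuousOn.isOpen_inter_preimage
    R.isOpen_Q isOpen_ne

theorem regular_subset : R.regular K ⊆ R.Q := fun _ h => h.1

theorem contDiffOn_inv_contactInertia (c c' : K) :
    ContDiffOn ℝ ∞ (fun q => (R.contactInertia K q)⁻¹ c c') (R.regular K) :=
  ContDiffOn.matrix_inv
    (fun i j => (R.contDiffOn_contactInertia K i j).mono (R.regular_subset K)) (fun _ h => h.2) c c'

theorem contDiffOn_proj (i j : Fin nq) :
    ContDiffOn ℝ ∞ (fun q => R.proj K q i j) (R.regular K) := by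
  have hJ : ∀ c j, ContDiffOn ℝ ∞ (fun q => R.jac K q c j) (R.regular K) := fun c j =>
    (R.contDiffOn_jac K c j).mono (R.regular_subset K)
  exact contDiffOn_const.sub (ContDiffOn.matrix_mul (ContDiffOn.matrix_mul (ContDiffOn.matrix_mul
    (fun i j => hJ j i) (R.contDiffOn_inv_contactInertia K)) hJ)
    (fun i j => (R.contDiffOn_inv_D i j).mono (R.regular_subset K)) i j)

/-- The states over regular configurations. -/
def regularState : Set (State nq) := {x | x.1 ∈ R.regular K}

theorem isOpen_regularState : IsOpen (R.regularState K) :=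
  (R.isOpen_regular K).preimage continuous_fst

theorem regularState_subset : R.regularState K ⊆ {x | x.1 ∈ R.Q} := fun _ h => h.1

theorem mapsTo_fst_regularState : MapsTo Prod.fst (R.regularState K) (R.regular K) := fun _ h => h

variable {K} in
theorem comp_fst {φ : Vec nq → ℝ} (h : ContDiffOn ℝ ∞ φ (R.regular K)) :
    ContDiffOn ℝ ∞ (fun x : State nq => φ x.1) (R.regularState K) :=
  h.comp contDiffOn_fst (R.mapsTo_fst_regularState K)

theorem contDiffOn_constrainedDrift (i : Fin nq) :
    ContDiffOn ℝ ∞ (fun x : State nq => R.constrainedDrift K x.1 x.2 i) (R.regularState K) := by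
  refine (ContDiffOn.matrix_mulVec (fun i j => R.comp_fst (R.contDiffOn_proj K i j))
    (fun j => (R.contDiffOn_drift j).mono (R.regularState_subset K)) i).add ?_
  exact ContDiffOn.matrix_mulVec
    (fun i j => R.comp_fst ((R.contDiffOn_jac K j i).mono (R.regular_subset K)))
    (ContDiffOn.matrix_mulVec (fun i j => R.comp_fst (R.contDiffOn_inv_contactInertia K i j))
      (fun j => (R.contDiffOn_jacDot K j).mono (R.regularState_subset K))) i

theorem contDiffOn_constrainedInput (i : Fin nq) (j : Fin m) :
    ContDiffOn ℝ ∞ (fun q => R.constrainedInput K q i j) (R.regular K) :=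
  ContDiffOn.matrix_mul (B := fun _ => R.B) (R.contDiffOn_proj K) (fun _ _ => contDiffOn_const) i j

theorem contDiffOn_impact (i : Fin nq) :
    ContDiffOn ℝ ∞ (fun x : State nq => R.impact K x.1 x.2 i) (R.regularState K) := by
  refine ContDiffOn.sub (by fun_prop) ?_
  exact ContDiffOn.matrix_mulVec
    (fun i j => R.comp_fst ((R.contDiffOn_inv_D i j).mono (R.regular_subset K)))
    (ContDiffOn.matrix_mulVec
      (fun i j => R.comp_fst ((R.contDiffOn_jac K j i).mono (R.regular_subset K)))
      (ContDiffOn.matrix_mulVec (fun i j => R.comp_fst (R.contDiffOn_inv_contactInertia K i j))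
        (fun j => (R.contDiffOn_jac_mulVec K j).mono (R.regularState_subset K)))) i

/-- Independent constraints have an invertible contact inertia matrix. -/
theorem mem_regular {q : Vec nq} (hq : q ∈ R.Q) (hr : (R.jac K q).rank = K.card) :
    q ∈ R.regular K := by
  refine ⟨hq, ?_⟩
  have hpd : ((R.D q)⁻¹).PosDef := (R.posDef_D q hq).inv
  -- Full row rank makes `Jᵀ` injective, so `J D⁻¹ Jᵀ` inherits positive definiteness from `D⁻¹`.
  have hinj : Function.Injective (R.jac K q).vecMul := by
    rw [Matrix.vecMul_injective_iff]
    rw [linearIndependent_iff_card_eq_finrank_span, Set.finrank, ← Matrix.rank_eq_finrank_span_row,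
      hr, Fintype.card_coe]
  have h2 : (R.contactInertia K q).PosDef := by
    have := hpd.mul_mul_conjTranspose_same (B := R.jac K q) hinj
    simpa [contactInertia, Matrix.conjTranspose_eq_transpose_of_trivial] using this
  exact h2.det_pos.ne'

end Robot

namespace HybridModel

variable {nq m : ℕ} {Con V : Type*} [DecidableEq Con] (M : HybridModel nq m Con V)

theorem contDiffOn_f (v : V) : ContDiffOn ℝ ∞ (M.f v) (M.regularState (M.contact v)) := by
  refine contDiffOn_snd.prodMk (contDiffOn_pi.2 fun i => ContDiffOn.neg ?_)
  exact ContDiffOn.matrix_mulVec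
    (fun i j => M.comp_fst ((M.contDiffOn_inv_D i j).mono (M.regular_subset _)))
    (M.contDiffOn_constrainedDrift _) i

theorem contDiffOn_g {E : Type*} [NormedAddCommGroup E] [NormedSpace ℝ E] {O : Set E} (v : V)
    {x : E → State nq} {u : E → Vec m} (hx : ContDiffOn ℝ ∞ x O) (hu : ContDiffOn ℝ ∞ u O)
    (hm : MapsTo x O (M.regularState (M.contact v))) :
    ContDiffOn ℝ ∞ (fun z => M.g v (x z) (u z)) O := by
  refine contDiffOn_const.prodMk (contDiffOn_pi.2 fun i => ?_)
  refine ContDiffOn.matrix_mulVec (fun i j => ?_) (ContDiffOn.matrix_mulVec (fun i j => ?_)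
    (fun j => contDiffOn_pi.1 hu j)) i
  · exact (M.comp_fst ((M.contDiffOn_inv_D i j).mono (M.regular_subset _))).comp hx hm
  · exact (M.comp_fst (M.contDiffOn_constrainedInput (M.contact v) i j)).comp hx hm

theorem contDiffOn_reset (v : V) :
    ContDiffOn ℝ ∞ (M.reset v) (M.regularState (M.contact (M.next v))) := by
  unfold reset
  split_ifs
  · exact contDiffOn_id
  · exact contDiffOn_fst.prodMk (contDiffOn_pi.2 fun i => M.contDiffOn_impact _ i)

@[simp] theorem reset_fst (v : V) (x : State nq) : (M.reset v x).1 = x.1 := by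
  unfold reset
  split_ifs <;> rfl

variable {M} in
theorem IsModel.regularState_of_mem_X (hM : M.IsModel) {v : V} {x : State nq} (hx : x ∈ M.X v) :
    x ∈ M.regularState (M.contact v) :=
  M.mem_regular _ hx.1 (hM.rank_jac v x.1 hx.1 hx.2.1)

end HybridModel

/-! ### Invariance of the state manifolds -/

namespace Robot

variable {nq m : ℕ} {Con : Type*} (R : Robot nq m Con) [DecidableEq Con] (K : Finset Con)

/-- The contact inertia `J D⁻¹ Jᵀ` cancels its inverse. Projected forces thus cause no acceleration
across the constraints, at all regular configurations and not only on the state manifold. -/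
theorem jac_mul_inv_D_mul_proj {q : Vec nq} (hq : q ∈ R.regular K) :
    R.jac K q * (R.D q)⁻¹ * R.proj K q = 0 := by
  have h : R.contactInertia K q * (R.contactInertia K q)⁻¹ = 1 :=
    Matrix.mul_nonsing_inv _ (isUnit_iff_ne_zero.2 hq.2)
  rw [proj, Matrix.mul_sub, Matrix.mul_one]
  have : R.jac K q * (R.D q)⁻¹ * ((R.jac K q)ᵀ * (R.contactInertia K q)⁻¹ * R.jac K q * (R.D q)⁻¹)
      = R.contactInertia K q * (R.contactInertia K q)⁻¹ * (R.jac K q * (R.D q)⁻¹) := by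
    simp only [contactInertia, Matrix.mul_assoc]
  rw [this, h, Matrix.one_mul, sub_self]

end Robot

theorem eq_of_hasDerivWithinAt_zero {F : Type*} [NormedAddCommGroup F] [NormedSpace ℝ F] {T : ℝ}
    {f : ℝ → F} (hf : ∀ t ∈ Icc 0 T, HasDerivWithinAt f 0 (Icc 0 T) t) :
    ∀ t ∈ Icc 0 T, f t = f 0 :=
  constant_of_has_deriv_right_zero (fun t ht => (hf t ht).continuousWithinAt)
    (fun t ht => (hf t (Ico_subset_Icc_self ht)).Ici_of_Icc ht)

namespace HybridModel

variable {nq m : ℕ} {Con V : Type*} (M : HybridModel nq m Con V)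

/-- The map whose zero set is the state manifold of the domain `v`. -/
def stateConstraint (v : V) (x : State nq) : (M.pinned v → ℝ) × (M.contact v → ℝ) :=
  (fun c : M.pinned v => M.η c x.1, M.jac (M.contact v) x.1 *ᵥ x.2)

theorem mem_X_iff {v : V} {x : State nq} : x ∈ M.X v ↔ x.1 ∈ M.Q ∧ M.stateConstraint v x = 0 := by
  simp only [X, stateConstraint, mem_ofPred_eq, Prod.mk_eq_zero, funext_iff, Subtype.forall,
    Pi.zero_apply]

theorem contDiffOn_stateConstraint (v : V) :
    ContDiffOn ℝ ∞ (M.stateConstraint v) {x | x.1 ∈ M.Q} :=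
  (contDiffOn_pi.2 fun c : M.pinned v => (M.smooth_η c).comp contDiffOn_fst fun _ hx => hx).prodMk
    (contDiffOn_pi.2 fun c : M.contact v => M.contDiffOn_jac_mulVec _ c)

theorem fderiv_η_apply (K : Finset Con) (c : K) (q dq : Vec nq) :
    fderiv ℝ (M.η c) q dq = (M.jac K q *ᵥ dq) c := by
  have : dq = ∑ j, dq j • (Pi.single j 1 : Vec nq) := by
    ext i
    simp [Finset.sum_apply, Pi.single_apply]
  conv_lhs => rw [this, map_sum]
  simp only [Matrix.mulVec, dotProduct, Robot.jac, Matrix.of_apply, map_smul, smul_eq_mul]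
  exact Finset.sum_congr rfl fun j _ => mul_comm _ _

theorem hasFDerivAt_stateConstraint (v : V) {x : State nq} (hx : x.1 ∈ M.Q) :
    HasFDerivAt (M.stateConstraint v) (fderiv ℝ (M.stateConstraint v) x) x :=
  (((M.contDiffOn_stateConstraint v).contDiffAt (M.isOpen_fst_mem_Q.mem_nhds hx)).differentiableAt
    (by simp)).hasFDerivAt

/-- The derivative of the state constraint. -/
theorem fderiv_stateConstraint_apply (v : V) {x : State nq} (hx : x.1 ∈ M.Q) (w : State nq) :
    fderiv ℝ (M.stateConstraint v) x w =
      (fun c : M.pinned v => (M.jac (M.contact v) x.1 *ᵥ w.1) ⟨c, M.pinned_subset v c.2⟩,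
        fun c : M.contact v => fderiv ℝ (fun q => (M.jac (M.contact v) q *ᵥ x.2) c) x.1 w.1 +
          (M.jac (M.contact v) x.1 *ᵥ w.2) c) := by
  have hd := M.hasFDerivAt_stateConstraint v hx
  have hQ : M.Q ∈ 𝓝 x.1 := M.isOpen_Q.mem_nhds hx
  refine Prod.ext (funext fun c => ?_) (funext fun c => ?_)
  · have h1 : HasFDerivAt (fun x : State nq => M.η c x.1)
        ((ContinuousLinearMap.proj c).comp ((ContinuousLinearMap.fst ℝ _ _).comp
          (fderiv ℝ (M.stateConstraint v) x))) x :=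
      ((ContinuousLinearMap.proj (R := ℝ) (φ := fun _ : M.pinned v => ℝ) c).comp
        (ContinuousLinearMap.fst ℝ _ (M.contact v → ℝ))).hasFDerivAt.comp x hd
    have h2 : HasFDerivAt (fun x : State nq => M.η c x.1) _ x :=
      (((M.smooth_η c).contDiffAt hQ).differentiableAt (by simp)).hasFDerivAt.comp x
        hasFDerivAt_fst
    have h3 := congrArg (fun L : State nq →L[ℝ] ℝ => L w) (h1.unique h2)
    simp only [ContinuousLinearMap.comp_apply, ContinuousLinearMap.proj_apply,
      ContinuousLinearMap.coe_fst'] at h3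
    rw [h3]
    exact M.fderiv_η_apply (M.contact v) ⟨c, M.pinned_subset v c.2⟩ x.1 w.1
  · have h1 : HasFDerivAt (fun x : State nq => (M.jac (M.contact v) x.1 *ᵥ x.2) c)
        ((ContinuousLinearMap.proj c).comp ((ContinuousLinearMap.snd ℝ _ _).comp
          (fderiv ℝ (M.stateConstraint v) x))) x :=
      ((ContinuousLinearMap.proj (R := ℝ) (φ := fun _ : M.contact v => ℝ) c).comp
        (ContinuousLinearMap.snd ℝ (M.pinned v → ℝ) _)).hasFDerivAt.comp x hd
    set L := (ContinuousLinearMap.proj (R := ℝ) (φ := fun _ : M.contact v => ℝ) c).comp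
      ((ContinuousLinearMap.snd ℝ (M.pinned v → ℝ) _).comp (fderiv ℝ (M.stateConstraint v) x))
    have h2 : HasFDerivAt (fun q => (M.jac (M.contact v) q *ᵥ x.2) c) _ x.1 :=
      HasFDerivAt.comp (f := fun q => (q, x.2)) x.1 h1 (hasFDerivAt_prodMk_left x.1 x.2)
    have h3 : HasFDerivAt (fun dq => (M.jac (M.contact v) x.1 *ᵥ dq) c) _ x.2 :=
      HasFDerivAt.comp (f := fun dq => (x.1, dq)) x.2 h1 (hasFDerivAt_prodMk_right x.1 x.2)
    have h4 : HasFDerivAt (fun dq => (M.jac (M.contact v) x.1 *ᵥ dq) c)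
        (((ContinuousLinearMap.proj (R := ℝ) (φ := fun _ : M.contact v => ℝ) c).comp
          (LinearMap.toContinuousLinearMap (M.jac (M.contact v) x.1).mulVecLin))) x.2 :=
      (((ContinuousLinearMap.proj (R := ℝ) (φ := fun _ : M.contact v => ℝ) c).comp
        (LinearMap.toContinuousLinearMap (M.jac (M.contact v) x.1).mulVecLin))).hasFDerivAt
    have h5 := congrArg (fun L : Vec nq →L[ℝ] ℝ => L w.2) (h3.unique h4)
    change L (0, w.2) = (M.jac (M.contact v) x.1 *ᵥ w.2) c at h5
    change L w = fderiv ℝ (fun q => (M.jac (M.contact v) q *ᵥ x.2) c) x.1 w.1 +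
      (M.jac (M.contact v) x.1 *ᵥ w.2) c
    rw [h2.fderiv]
    change L w = L (w.1, 0) + (M.jac (M.contact v) x.1 *ᵥ w.2) c
    rw [← h5, ← map_add]
    simp

variable [DecidableEq Con]

/-- The constrained dynamics satisfy `J q'' = -(∂/∂q (J q')) q'`. -/
theorem jac_mulVec_acceleration (v : V) {x : State nq} (hx : x ∈ M.regularState (M.contact v))
    (u : Vec m) :
    M.jac (M.contact v) x.1 *ᵥ (M.f v x + M.g v x u).2 = -M.jacDot (M.contact v) x.1 x.2 := by
  set K := M.contact v
  have h1 := M.jac_mul_inv_D_mul_proj K hx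
  have h2 : M.contactInertia K x.1 * (M.contactInertia K x.1)⁻¹ = 1 :=
    Matrix.mul_nonsing_inv _ (isUnit_iff_ne_zero.2 hx.2)
  have h3 : M.jac K x.1 *ᵥ ((M.D x.1)⁻¹ *ᵥ M.constrainedDrift K x.1 x.2) =
      M.jacDot K x.1 x.2 := by
    have e : M.jac K x.1 * ((M.D x.1)⁻¹ * ((M.jac K x.1)ᵀ * (M.contactInertia K x.1)⁻¹)) = 1 := by
      rw [← h2]
      simp only [Robot.contactInertia, Matrix.mul_assoc]
    rw [Robot.constrainedDrift, Matrix.mulVec_add, Matrix.mulVec_add]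
    simp only [Matrix.mulVec_mulVec]
    rw [e, ← Matrix.mul_assoc, h1]
    simp
  have h4 : M.jac K x.1 *ᵥ ((M.D x.1)⁻¹ *ᵥ (M.constrainedInput K x.1 *ᵥ u)) = 0 := by
    simp only [Matrix.mulVec_mulVec, Robot.constrainedInput]
    rw [← Matrix.mul_assoc, ← Matrix.mul_assoc, h1]
    simp
  change M.jac K x.1 *ᵥ (-((M.D x.1)⁻¹ *ᵥ M.constrainedDrift K x.1 x.2) +
    (M.D x.1)⁻¹ *ᵥ (M.constrainedInput K x.1 *ᵥ u)) = _
  rw [Matrix.mulVec_add, Matrix.mulVec_neg, h3, h4, add_zero]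

/-- Solutions of the constrained dynamics do not leave the state manifold. -/
theorem fderiv_stateConstraint_field (v : V) {x : State nq}
    (hx : x ∈ M.regularState (M.contact v)) (u : Vec m) :
    fderiv ℝ (M.stateConstraint v) x (M.f v x + M.g v x u) =
      (fun c : M.pinned v => (M.stateConstraint v x).2 ⟨c, M.pinned_subset v c.2⟩, 0) := by
  rw [M.fderiv_stateConstraint_apply v hx.1]
  have h1 : (M.f v x + M.g v x u).1 = x.2 := by simp [f, g]
  rw [M.jac_mulVec_acceleration v hx, h1]
  refine Prod.ext rfl (funext fun c => ?_)
  simp [Robot.jacDot]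

/-- The derivative is block triangular and `D⁻¹ Jᵀ (J D⁻¹ Jᵀ)⁻¹` is a right inverse of `J`: the
position component is solved first, with value `0` chosen at contacts that are not pinned, and the
velocity component is then corrected. -/
theorem range_fderiv_stateConstraint (v : V) {x : State nq}
    (hx : x ∈ M.regularState (M.contact v)) (y : (M.pinned v → ℝ) × (M.contact v → ℝ)) :
    ∃ w, fderiv ℝ (M.stateConstraint v) x w = y := by
  have hJ : ∀ z : M.contact v → ℝ, ∃ w, M.jac (M.contact v) x.1 *ᵥ w = z := by
    intro z
    refine ⟨((M.D x.1)⁻¹ * (M.jac (M.contact v) x.1)ᵀ * (M.contactInertia (M.contact v) x.1)⁻¹) *ᵥ z, ?_⟩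
    rw [Matrix.mulVec_mulVec]
    have h2 : M.contactInertia (M.contact v) x.1 * (M.contactInertia (M.contact v) x.1)⁻¹ = 1 :=
      Matrix.mul_nonsing_inv _ (isUnit_iff_ne_zero.2 hx.2)
    have : M.jac (M.contact v) x.1 * ((M.D x.1)⁻¹ * (M.jac (M.contact v) x.1)ᵀ *
        (M.contactInertia (M.contact v) x.1)⁻¹) = 1 := by
      rw [← h2]
      simp only [Robot.contactInertia, Matrix.mul_assoc]
    rw [this, Matrix.one_mulVec]
  classical
  obtain ⟨w1, h1⟩ := hJ fun c => if h : (c : Con) ∈ M.pinned v then y.1 ⟨c, h⟩ else 0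
  obtain ⟨w2, h2⟩ := hJ fun c => y.2 c - fderiv ℝ (fun q => (M.jac (M.contact v) q *ᵥ x.2) c) x.1 w1
  refine ⟨(w1, w2), ?_⟩
  rw [M.fderiv_stateConstraint_apply v hx.1]
  refine Prod.ext (funext fun c => ?_) (funext fun c => ?_)
  · simp [h1]
  · simp [h2]

/-- A solution of the constrained dynamics that starts on the state manifold remains on it. -/
theorem mem_X_of_solution {v : V} {T : ℝ} {γ : ℝ → State nq} {u : ℝ → Vec m}
    (h0 : γ 0 ∈ M.X v)
    (hγ : ∀ t ∈ Icc 0 T, γ t ∈ M.regularState (M.contact v) ∧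
      HasDerivWithinAt γ (M.f v (γ t) + M.g v (γ t) (u t)) (Icc 0 T) t) :
    ∀ t ∈ Icc 0 T, γ t ∈ M.X v := by
  have hder : ∀ t ∈ Icc 0 T, HasDerivWithinAt (fun t => M.stateConstraint v (γ t))
      (fun c : M.pinned v => (M.stateConstraint v (γ t)).2 ⟨c, M.pinned_subset v c.2⟩, 0) (Icc 0 T) t := by
    intro t ht
    rw [← M.fderiv_stateConstraint_field v (hγ t ht).1 (u t)]
    exact (M.hasFDerivAt_stateConstraint v (hγ t ht).1.1).comp_hasDerivWithinAt t (hγ t ht).2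
  have hz := (M.mem_X_iff.1 h0).2
  -- The velocity constraint comes first: it is constant along solutions. Only once it vanishes is
  -- the position constraint constant too.
  have h2 : ∀ t ∈ Icc 0 T, (M.stateConstraint v (γ t)).2 = 0 := by
    intro t ht
    rw [eq_of_hasDerivWithinAt_zero (f := fun t => (M.stateConstraint v (γ t)).2)
      (fun t ht => (ContinuousLinearMap.snd ℝ (M.pinned v → ℝ)
        (M.contact v → ℝ)).hasFDerivAt.comp_hasDerivWithinAt t (hder t ht)) t ht]
    exact congrArg Prod.snd hz
  have h1 : ∀ t ∈ Icc 0 T, (M.stateConstraint v (γ t)).1 = 0 := by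
    intro t ht
    rw [eq_of_hasDerivWithinAt_zero (f := fun t => (M.stateConstraint v (γ t)).1)
      (fun t ht => ?_) t ht]
    · exact congrArg Prod.fst hz
    · have := (ContinuousLinearMap.fst ℝ (M.pinned v → ℝ)
        (M.contact v → ℝ)).hasFDerivAt.comp_hasDerivWithinAt t (hder t ht)
      simp only [h2 t ht] at this
      exact this
  exact fun t ht => M.mem_X_iff.2 ⟨(hγ t ht).1.1, Prod.ext (h1 t ht) (h2 t ht)⟩

end HybridModel

/-! ### The closed-loop field and its trajectories -/

namespace ControlFamily

variable {nq m : ℕ} {Con V : Type*} [DecidableEq Con] {c : ControlFamily nq V}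
  {M : HybridModel nq m Con V} {a : HybridArc nq m V} {T : ℝ}

variable (c M) in
/-- The states and parameters at which the outputs have Lie derivatives. -/
def outputDomain (v : V) : Set (State nq × Vec (c.p v)) :=
  M.regularState (M.contact v) ×ˢ c.Ξ v

variable (c M) in
/-- The states and parameters at which the closed-loop field is defined. -/
def closedLoopDomain (v : V) : Set (State nq × Vec (c.p v)) :=
  {z | z ∈ c.outputDomain M v ∧
    (c.decoupling M v z.2 z.1 * (c.decoupling M v z.2 z.1)ᵀ).det ≠ 0}

/-- `A` and `A Aᵀ` have the same rank. The rank condition becomes the non-vanishing of a smooth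
function, an open condition. -/
theorem det_ne_zero_iff_fullRank {v : V} {ξ : Vec (c.p v)} {x : State nq} :
    (c.decoupling M v ξ x * (c.decoupling M v ξ x)ᵀ).det ≠ 0 ↔ c.FullRank M v ξ x := by
  rw [FullRank, ← Matrix.rank_self_mul_transpose, ← isUnit_iff_ne_zero,
    ← Matrix.isUnit_iff_isUnit_det]
  refine ⟨fun h => Matrix.rank_of_isUnit _ h, fun h => ?_⟩
  rw [← Matrix.linearIndependent_rows_iff_isUnit, linearIndependent_iff_card_eq_finrank_span,
    Set.finrank, ← Matrix.rank_eq_finrank_span_row, h]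

theorem IsFamily.isOpen_outputDomain (hc : c.IsFamily M a T) (v : V) :
    IsOpen (c.outputDomain M v) :=
  (M.isOpen_regularState _).prod (hc.isOpen_Ξ v)

theorem IsFamily.contDiffOn_y1 (hc : c.IsFamily M a T) (hτ : ∀ v, ContDiffOn ℝ ∞ (c.τ v) M.Q)
    (v : V) : ContDiffOn ℝ ∞ (c.y1 v) {x | x.1 ∈ M.Q} := by
  refine ContDiffOn.sub ?_ ((hc.smooth_sd v).comp_contDiffOn
    ((hτ v).comp contDiffOn_fst fun _ hx => hx))
  simp only [dotProduct]
  exact ContDiffOn.sum fun i _ =>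
    ((hc.smooth_Js v i).comp contDiffOn_fst fun _ hx => hx).mul (by fun_prop)

theorem IsFamily.contDiffOn_y2 (hc : c.IsFamily M a T) (hτ : ∀ v, ContDiffOn ℝ ∞ (c.τ v) M.Q)
    (v : V) (i : Fin (c.m2 v)) :
    ContDiffOn ℝ ∞ (fun z : State nq × Vec (c.p v) => c.y2 v z.2 i z.1)
      ({x | x.1 ∈ M.Q} ×ˢ c.Ξ v) := by
  have hq : ContDiffOn ℝ ∞ (fun z : State nq × Vec (c.p v) => c.qd v (c.τ v z.1.1))
      ({x | x.1 ∈ M.Q} ×ˢ c.Ξ v) :=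
    (hc.smooth_qd v).comp_contDiffOn ((hτ v).comp (by fun_prop) fun _ hz => hz.1)
  refine ContDiffOn.matrix_mulVec
    (fun i j => (hc.smooth_H v i j).comp contDiffOn_snd fun _ hz => hz.2) (fun j => ?_) i
  exact ContDiffOn.sub (by fun_prop) (contDiffOn_pi.1 hq j)

section Lie

variable {P : Type*} [NormedAddCommGroup P] [NormedSpace ℝ P] {Ω : Set P} (hΩ : IsOpen Ω) {v : V}
  {h : P → State nq → ℝ}
  (hh : ContDiffOn ℝ ∞ (fun z : State nq × P => h z.2 z.1) (M.regularState (M.contact v) ×ˢ Ω))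

include hΩ hh

theorem contDiffOn_lieF :
    ContDiffOn ℝ ∞ (fun z : State nq × P => lieF M v (h z.2) z.1)
      (M.regularState (M.contact v) ×ˢ Ω) :=
  hh.fderiv_partial ((M.isOpen_regularState _).prod hΩ)
    ((M.contDiffOn_f v).comp contDiffOn_fst fun _ hz => hz.1)

theorem contDiffOn_lieG (j : Fin m) :
    ContDiffOn ℝ ∞ (fun z : State nq × P => lieG M v (h z.2) z.1 j)
      (M.regularState (M.contact v) ×ˢ Ω) :=
  hh.fderiv_partial ((M.isOpen_regularState _).prod hΩ)
    (M.contDiffOn_g v contDiffOn_fst contDiffOn_const fun _ hz => hz.1)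

end Lie

section Controller

variable (hc : c.IsFamily M a T) (hτ : ∀ v, ContDiffOn ℝ ∞ (c.τ v) M.Q) (v : V)
include hc hτ

theorem contDiffOn_y1_outputDomain :
    ContDiffOn ℝ ∞ (fun z : State nq × Vec (c.p v) => c.y1 v z.1) (c.outputDomain M v) :=
  (hc.contDiffOn_y1 hτ v).comp contDiffOn_fst fun _ hz => M.regularState_subset _ hz.1

theorem contDiffOn_y2_outputDomain (i : Fin (c.m2 v)) :
    ContDiffOn ℝ ∞ (fun z : State nq × Vec (c.p v) => c.y2 v z.2 i z.1) (c.outputDomain M v) :=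
  (hc.contDiffOn_y2 hτ v i).mono (prod_mono (M.regularState_subset _) subset_rfl)

theorem contDiffOn_decoupling (i : c.Row v) (j : Fin m) :
    ContDiffOn ℝ ∞ (fun z : State nq × Vec (c.p v) => c.decoupling M v z.2 z.1 i j)
      (c.outputDomain M v) := by
  rcases i with i | i
  · exact contDiffOn_lieG (hc.isOpen_Ξ v) (h := fun _ => c.y1 v)
      (contDiffOn_y1_outputDomain hc hτ v) j
  · exact contDiffOn_lieG (hc.isOpen_Ξ v) (h := fun ξ => lieF M v (c.y2 v ξ i))
      (contDiffOn_lieF (hc.isOpen_Ξ v) (h := fun ξ => c.y2 v ξ i)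
        (contDiffOn_y2_outputDomain hc hτ v i)) j

theorem contDiffOn_bvec_add_wvec (i : c.Row v) :
    ContDiffOn ℝ ∞
      (fun z : State nq × Vec (c.p v) => (c.bvec M v z.2 z.1 + c.wvec M v z.2 z.1) i)
      (c.outputDomain M v) := by
  rcases i with i | i
  · have h1 := contDiffOn_y1_outputDomain hc hτ v
    exact (contDiffOn_lieF (hc.isOpen_Ξ v) (h := fun _ => c.y1 v) h1).add (contDiffOn_const.mul h1)
  · have h2 := contDiffOn_y2_outputDomain hc hτ v i
    have h3 := contDiffOn_lieF (hc.isOpen_Ξ v) (h := fun ξ => c.y2 v ξ i) h2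
    have h4 := contDiffOn_lieF (hc.isOpen_Ξ v) (h := fun ξ => lieF M v (c.y2 v ξ i)) h3
    exact h4.add ((contDiffOn_const.mul h2).add (contDiffOn_const.mul h3))

theorem contDiffOn_decoupling_gram (i j : c.Row v) :
    ContDiffOn ℝ ∞ (fun z : State nq × Vec (c.p v) =>
      (c.decoupling M v z.2 z.1 * (c.decoupling M v z.2 z.1)ᵀ) i j) (c.outputDomain M v) :=
  ContDiffOn.matrix_mul (contDiffOn_decoupling hc hτ v)
    (fun i j => contDiffOn_decoupling hc hτ v j i) i j

theorem isOpen_closedLoopDomain : IsOpen (c.closedLoopDomain M v) :=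
  (ContDiffOn.matrix_det (contDiffOn_decoupling_gram hc hτ v)).continuousOn.isOpen_inter_preimage
    (hc.isOpen_outputDomain v) isOpen_ne

theorem contDiffOn_Γ :
    ContDiffOn ℝ ∞ (fun z : State nq × Vec (c.p v) => c.Γ M v z.2 z.1)
      (c.closedLoopDomain M v) := by
  have hsub : c.closedLoopDomain M v ⊆ c.outputDomain M v := fun _ h => h.1
  refine contDiffOn_pi.2 fun i => ContDiffOn.neg ?_
  refine ContDiffOn.matrix_mulVec (fun i j => (contDiffOn_decoupling hc hτ v j i).mono hsub)
    (ContDiffOn.matrix_mulVec ?_ fun i => (contDiffOn_bvec_add_wvec hc hτ v i).mono hsub) i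
  exact ContDiffOn.matrix_inv (fun i j => (contDiffOn_decoupling_gram hc hτ v i j).mono hsub)
    fun z hz => hz.2

theorem contDiffOn_fcl :
    ContDiffOn ℝ ∞ (fun z : State nq × Vec (c.p v) => c.fcl M v z.2 z.1)
      (c.closedLoopDomain M v) :=
  ((M.contDiffOn_f v).comp contDiffOn_fst fun _ hz => hz.1.1).add
    (M.contDiffOn_g v contDiffOn_fst (contDiffOn_Γ hc hτ v) fun _ hz => hz.1.1)

end Controller

variable (c M) in
/-- The closed-loop field on states and parameters; the parameters are constant in time. -/
def extField (v : V) (z : State nq × Vec (c.p v)) : State nq × Vec (c.p v) :=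
  (c.fcl M v z.2 z.1, 0)

theorem contDiffOn_extField (hc : c.IsFamily M a T) (hτ : ∀ v, ContDiffOn ℝ ∞ (c.τ v) M.Q)
    (v : V) : ContDiffOn ℝ ∞ (c.extField M v) (c.closedLoopDomain M v) :=
  (contDiffOn_fcl hc hτ v).prodMk contDiffOn_const

theorem mem_closedLoopDomain (hM : M.IsModel) {v : V} {ξ : Vec (c.p v)} (hξ : ξ ∈ c.Ξ v)
    {x : State nq} (hx : x ∈ c.Xcl M v ξ) : (x, ξ) ∈ c.closedLoopDomain M v :=
  ⟨⟨hM.regularState_of_mem_X hx.1, hξ⟩, det_ne_zero_iff_fullRank.2 hx.2⟩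

/-- Trajectories of the closed loop are unique. -/
theorem IsTrajectory.eqOn (hM : M.IsModel) (hc : c.IsFamily M a T)
    (hτ : ∀ v, ContDiffOn ℝ ∞ (c.τ v) M.Q) {v : V} {ξ : Vec (c.p v)} (hξ : ξ ∈ c.Ξ v)
    {x₀ : State nq} {t : ℝ} {γ₁ γ₂ : ℝ → State nq} (h1 : c.IsTrajectory M v ξ x₀ t γ₁)
    (h2 : c.IsTrajectory M v ξ x₀ t γ₂) : EqOn γ₁ γ₂ (Icc 0 t) := by
  have key : ∀ {γ}, c.IsTrajectory M v ξ x₀ t γ → ∀ s ∈ Icc 0 t,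
      (γ s, ξ) ∈ c.closedLoopDomain M v ∧
        HasDerivWithinAt (fun s => (γ s, ξ)) (c.extField M v (γ s, ξ)) (Icc 0 t) s := fun h s hs =>
    ⟨mem_closedLoopDomain hM hξ (h.2 s hs).1,
      (h.2 s hs).2.prodMk (hasDerivWithinAt_const s _ ξ)⟩
  have := solution_unique_of_contDiffOn (isOpen_closedLoopDomain hc hτ v)
    ((contDiffOn_extField hc hτ v).of_le (by simp)) (γ₁ := fun s => (γ₁ s, ξ))
    (γ₂ := fun s => (γ₂ s, ξ)) (by simp [h1.1, h2.1]) (key h1) (key h2)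
  exact fun s hs => congrArg Prod.fst (this hs)

/-- `flow` selects a trajectory by choice; uniqueness makes the choice immaterial. -/
theorem IsTrajectory.flow_eq (hM : M.IsModel) (hc : c.IsFamily M a T)
    (hτ : ∀ v, ContDiffOn ℝ ∞ (c.τ v) M.Q) {v : V} {ξ : Vec (c.p v)} (hξ : ξ ∈ c.Ξ v)
    {x₀ : State nq} {t : ℝ} (ht : 0 ≤ t) {γ : ℝ → State nq} (h : c.IsTrajectory M v ξ x₀ t γ) :
    c.flow M v ξ t x₀ = γ t := by
  have hex : ∃ γ, c.IsTrajectory M v ξ x₀ t γ := ⟨γ, h⟩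
  rw [flow, dif_pos hex]
  exact hex.choose_spec.eqOn hM hc hτ hξ h ⟨ht, le_rfl⟩

end ControlFamily

/-! ### Transversal crossings and the Poincaré map of one domain -/

namespace ControlFamily

variable {nq m : ℕ} {Con V : Type*} [DecidableEq Con] {c : ControlFamily nq V}
  {M : HybridModel nq m Con V} {a : HybridArc nq m V} {T : ℝ}

/-- A closed-loop field that is not tangent to the switching manifold crosses it transversally. -/
theorem fderiv_fcl_ne_zero (hM : M.IsModel) {v : V} {ξ : Vec (c.p v)} (hξ : ξ ∈ c.Ξ v)
    {x : State nq} (hx : x ∈ c.switchSet M v ξ) {W : Set (State nq × Vec (c.p v))}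
    {h : State nq × Vec (c.p v) → ℝ} (hW : IsOpen W) (hxW : (x, ξ) ∈ W) (hh : ContDiffOn ℝ ∞ h W)
    (hiff : ∀ z ∈ W, z.1 ∈ M.X v → z.2 ∈ c.Ξ v → (z.1 ∈ c.switchSet M v z.2 ↔ h z = 0))
    {w : State nq} (hw : w ∈ tangentConeAt ℝ (M.X v) x)
    (hw0 : fderiv ℝ (fun x => h (x, ξ)) x w ≠ 0)
    (htrans : c.fcl M v ξ x ∉ tangentConeAt ℝ (c.switchSet M v ξ) x) :
    fderiv ℝ (fun x => h (x, ξ)) x (c.fcl M v ξ x) ≠ 0 := by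
  intro h0
  apply htrans
  have hxX : x ∈ M.X v := hx.1.1
  have hreg := hM.regularState_of_mem_X hxX
  have hsc0 : M.stateConstraint v x = 0 := (M.mem_X_iff.1 hxX).2
  have hhc : ContDiffAt ℝ ∞ (fun x => h (x, ξ)) x :=
    ContDiffAt.comp (f := fun x => (x, ξ)) x (hh.contDiffAt (hW.mem_nhds hxW)) (by fun_prop)
  have hsc : ContDiffAt ℝ ∞ (M.stateConstraint v) x :=
    (M.contDiffOn_stateConstraint v).contDiffAt (M.isOpen_fst_mem_Q.mem_nhds hxX.1)
  have hG := (hsc.hasStrictFDerivAt (by simp)).prodMk (hhc.hasStrictFDerivAt (by simp))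
  have hwsc : fderiv ℝ (M.stateConstraint v) x w = 0 :=
    (M.hasFDerivAt_stateConstraint v hxX.1).eq_zero_of_mem_tangentConeAt
      (fun y hy => by rw [hsc0, (M.mem_X_iff.1 hy).2]) hw
  -- The vector `w₀` realizes the first component; a multiple of `w`, which is in the kernel of the
  -- state constraint's derivative, adjusts the second.
  have hsurj : ((fderiv ℝ (M.stateConstraint v) x).prod (fderiv ℝ (fun x => h (x, ξ)) x)).range
      = ⊤ := by
    refine LinearMap.range_eq_top.2 fun y => ?_
    obtain ⟨w₀, hw₀⟩ := M.range_fderiv_stateConstraint v hreg y.1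
    refine ⟨w₀ + ((y.2 - fderiv ℝ (fun x => h (x, ξ)) x w₀) /
      fderiv ℝ (fun x => h (x, ξ)) x w) • w, ?_⟩
    refine Prod.ext ?_ ?_
    · change fderiv ℝ (M.stateConstraint v) x _ = _
      rw [map_add, map_smul, hwsc, hw₀, smul_zero, add_zero]
    · change fderiv ℝ (fun x => h (x, ξ)) x _ = _
      rw [map_add, map_smul, smul_eq_mul, div_mul_cancel₀ _ hw0]
      ring
  have hker : (fderiv ℝ (M.stateConstraint v) x).prod (fderiv ℝ (fun x => h (x, ξ)) x)
      (c.fcl M v ξ x) = 0 := by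
    refine Prod.ext ?_ h0
    change fderiv ℝ (M.stateConstraint v) x (M.f v x + M.g v x (c.Γ M v ξ x)) = 0
    rw [M.fderiv_stateConstraint_field v hreg, hsc0]
    rfl
  have hmem := hG.ker_subset_tangentConeAt hsurj hker
  -- Near `x` the joint level set lies in the switching manifold, and tangent cones depend only on
  -- the set near the point.
  have hN : {y : State nq | y.1 ∈ M.Q ∧ (y, ξ) ∈ W} ∈ 𝓝 x :=
    (M.isOpen_fst_mem_Q.inter (hW.preimage (by fun_prop : Continuous fun y => (y, ξ)))).mem_nhds
      ⟨hxX.1, hxW⟩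
  rw [← tangentConeAt_inter_nhds hN] at hmem
  refine tangentConeAt_mono ?_ hmem
  rintro y ⟨hy, hyQ, hyW⟩
  have hy : (M.stateConstraint v y, h (y, ξ)) = (M.stateConstraint v x, h (x, ξ)) := hy
  rw [hsc0, (hiff _ hxW hxX hξ).1 hx, Prod.mk.injEq] at hy
  exact (hiff _ hyW (M.mem_X_iff.2 ⟨hyQ, hy.1⟩) hξ).2 hy.2

/-- Near a solution of a domain that crosses the switching manifold transversally at its end and
stays away from the guard before, the generalized Poincaré map is the restriction of a `C²` map. -/
theorem exists_local_poincare (hM : M.IsModel) (hc : c.IsFamily M a T)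
    (hτ : ∀ v, ContDiffOn ℝ ∞ (c.τ v) M.Q) (hreg : c.RegularSections M) {v : V}
    {ξ₀ : Vec (c.p v)} (hξ₀ : ξ₀ ∈ c.Ξ v) {x₀ : State nq} {θ : ℝ} (hθ : 0 < θ)
    {γ : ℝ → State nq} (hγ : c.IsTrajectory M v ξ₀ x₀ θ γ)
    (hguard : ∀ t ∈ Ico 0 θ, (γ t, c.Γ M v ξ₀ (γ t)) ∉ closure (M.guard v))
    (hhit : γ θ ∈ c.switchSet M v ξ₀)
    (htrans : c.fcl M v ξ₀ (γ θ) ∉ tangentConeAt ℝ (c.switchSet M v ξ₀) (γ θ)) :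
    ∃ Pe : State nq × Vec (c.p v) → State nq, ContDiffAt ℝ 2 Pe (x₀, ξ₀) ∧ Pe (x₀, ξ₀) = γ θ ∧
      ∀ᶠ z in 𝓝 (x₀, ξ₀), z.1 ∈ M.X v →
        (∃ t, IsLeast (c.hitTimes M v z.2 z.1) t) ∧
        c.flow M v z.2 (c.switchTime M v z.2 z.1) z.1 = Pe z ∧ Pe z ∈ c.switchSet M v z.2 := by
  obtain ⟨W, h, hW, hxW, hh, hiff, w, hw, hw0⟩ := hreg v ξ₀ hξ₀ (γ θ) hhit
  have hd0 := fderiv_fcl_ne_zero hM hξ₀ hhit hW hxW hh hiff hw hw0 htrans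
  have hO := isOpen_closedLoopDomain hc hτ v
  have hY := contDiffOn_extField hc hτ v
  -- The parameters are part of the initial value, so one flow gives joint regularity in state and
  -- parameters.
  obtain ⟨φ, ε, hε, hφ, hφ0, hφγ, hφd⟩ := exists_flow_near_solution 2 two_ne_zero hO
    (hY.of_le ENat.LEInfty.out) hθ.le (γ := fun t => (γ t, ξ₀)) (fun t ht =>
      ⟨mem_closedLoopDomain hM hξ₀ (hγ.2 t ht).1,
        (hγ.2 t ht).2.prodMk (hasDerivWithinAt_const t _ ξ₀)⟩)
  rw [hγ.1] at hφγ hφd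
  have hφθ : φ (θ, (x₀, ξ₀)) = (γ θ, ξ₀) := hφγ θ ⟨hθ.le, le_rfl⟩
  have hhd : DifferentiableAt ℝ h (γ θ, ξ₀) :=
    (hh.contDiffAt (hW.mem_nhds hxW)).differentiableAt (by simp)
  have hder : HasDerivAt (fun t => h (φ (t, (x₀, ξ₀))))
      (fderiv ℝ (fun x => h (x, ξ₀)) (γ θ) (c.fcl M v ξ₀ (γ θ))) θ := by
    have h1 := (hφd.self_of_nhds θ ⟨hθ.le, by linarith⟩).2
    rw [hφθ] at h1
    have h2 : HasFDerivAt h (fderiv ℝ h (γ θ, ξ₀)) (φ (θ, (x₀, ξ₀))) := by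
      rw [hφθ]
      exact hhd.hasFDerivAt
    have h3 := hhd.hasFDerivAt.comp (γ θ) (hasFDerivAt_prodMk_left (𝕜 := ℝ) (γ θ) ξ₀)
    have h4 : fderiv ℝ (fun x => h (x, ξ₀)) (γ θ) = _ := h3.fderiv
    rw [h4]
    exact h2.comp_hasDerivAt θ h1
  obtain ⟨τ, hτc, hτ0, hτiff⟩ := exists_hitting_time (n := 2) two_ne_zero (h := h)
    hφ.contDiffAt (by
      rw [hφθ]
      exact (hh.contDiffAt (hW.mem_nhds hxW)).of_le ENat.LEInfty.out)
    (by
      rw [hφθ]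
      exact (hiff _ hxW hhit.1.1 hξ₀).1 hhit) hder hd0
  refine ⟨fun z => (φ (τ z, z)).1, ?_, ?_, ?_⟩
  · exact contDiff_fst.contDiffAt.comp _ (hφ.contDiffAt.comp _ (hτc.prodMk contDiffAt_id))
  · simp only [hτ0, hφθ]
  have hφW : ∀ᶠ p : (State nq × Vec (c.p v)) × ℝ in 𝓝 ((x₀, ξ₀), θ), φ (p.2, p.1) ∈ W := by
    have hcont : Continuous fun p : (State nq × Vec (c.p v)) × ℝ => φ (p.2, p.1) :=
      hφ.continuous.comp (by fun_prop)
    exact hcont.continuousAt.eventually_mem (hW.mem_nhds (by simpa only [hφθ] using hxW))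
  have hev := hτiff.and hφW
  rw [nhds_prod_eq] at hev
  obtain ⟨pz, hpz, pt, hpt, hp⟩ := eventually_prod_iff.1 hev
  obtain ⟨δ₀, hδ₀, hball⟩ := Metric.eventually_nhds_iff.1 hpt
  -- Within `δ` of `θ` the crossing is unique (`δ ≤ δ₀`), solutions still exist (`δ ≤ ε`) and times
  -- are positive (`δ < θ`).
  obtain ⟨δ, hδ, hδδ₀, hδε, hδθ⟩ : ∃ δ > 0, δ ≤ δ₀ ∧ δ ≤ ε ∧ δ < θ :=
    ⟨min δ₀ (min ε (θ / 2)), by positivity, min_le_left _ _,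
      (min_le_right _ _).trans (min_le_left _ _),
      ((min_le_right _ _).trans (min_le_right _ _)).trans_lt (by linarith)⟩
  let N : Set (State nq × Vec (c.p v)) := c.closedLoopDomain M v ∩
    (fun z => (z.1, c.Γ M v z.2 z.1)) ⁻¹' (closure (M.guard v))ᶜ
  have hN : IsOpen N :=
    (contDiffOn_fst.prodMk (contDiffOn_Γ hc hτ v)).continuousOn.isOpen_inter_preimage hO
      isClosed_closure.isOpen_compl
  -- Up to time `θ - δ` the reference solution is a compact arc off the closed set `closure (M.guard
  -- v)`; nearby solutions avoid it as well.
  obtain ⟨u, N', -, hN', hIu, h0N', huN⟩ := generalized_tube_lemma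
    (isCompact_Icc (a := 0) (b := θ - δ)) (isCompact_singleton (x := (x₀, ξ₀)))
    (hN.preimage hφ.continuous) (by
      rintro ⟨t, z⟩ ⟨ht, hz⟩
      obtain rfl : z = (x₀, ξ₀) := hz
      have ht' : t ∈ Ico 0 θ := ⟨ht.1, by linarith [ht.2]⟩
      change φ (t, (x₀, ξ₀)) ∈ N
      rw [hφγ t (Ico_subset_Icc_self ht')]
      exact ⟨mem_closedLoopDomain hM hξ₀ (hγ.2 t (Ico_subset_Icc_self ht')).1, hguard t ht'⟩)
  have hτδ : ∀ᶠ z in 𝓝 (x₀, ξ₀), |τ z - θ| < δ := by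
    have := hτc.continuousAt.eventually (Metric.ball_mem_nhds _ hδ)
    rw [hτ0] at this
    simpa [Real.dist_eq] using this
  filter_upwards [hφd, hpz, hN'.mem_nhds (h0N' rfl), hτδ] with z hz hpzz hzN hzτ hzX
  have hzsnd : ∀ t ∈ Icc 0 (θ + ε), (φ (t, z)).2 = z.2 := by
    intro t ht
    have := eq_of_hasDerivWithinAt_zero (T := θ + ε) (f := fun t => (φ (t, z)).2)
      (fun t ht => ((ContinuousLinearMap.snd ℝ (State nq) (Vec (c.p v))).hasFDerivAt.comp_hasDerivAt
        t (hz t ht).2).hasDerivWithinAt) t ht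
    simpa only [hφ0] using this
  have hzΞ : z.2 ∈ c.Ξ v := by
    have := (hz 0 ⟨le_rfl, by linarith⟩).1
    rw [hφ0] at this
    exact this.1.2
  have hzder : ∀ t ∈ Icc 0 (θ + ε),
      HasDerivAt (fun t => (φ (t, z)).1) (c.fcl M v z.2 (φ (t, z)).1) t := by
    intro t ht
    have := (ContinuousLinearMap.fst ℝ (State nq) (Vec (c.p v))).hasFDerivAt.comp_hasDerivAt
      t (hz t ht).2
    rw [← hzsnd t ht]
    exact this
  -- The flow `φ` is built without regard to the state manifold; this is where the restriction to
  -- initial states in `M.X v` enters.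
  have hzmemX : ∀ t ∈ Icc 0 (θ + ε), (φ (t, z)).1 ∈ M.X v :=
    M.mem_X_of_solution (v := v) (γ := fun t => (φ (t, z)).1)
      (u := fun t => c.Γ M v z.2 (φ (t, z)).1) (by simpa only [hφ0] using hzX)
      fun t ht => ⟨(hz t ht).1.1.1, (hzder t ht).hasDerivWithinAt⟩
  have htraj : ∀ t ∈ Icc 0 (θ + ε), c.IsTrajectory M v z.2 z.1 t (fun t => (φ (t, z)).1) := by
    refine fun t ht => ⟨by simp only [hφ0], fun s hs => ?_⟩
    have hs' : s ∈ Icc 0 (θ + ε) := ⟨hs.1, hs.2.trans ht.2⟩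
    refine ⟨⟨hzmemX s hs', ?_⟩, (hzder s hs').hasDerivWithinAt⟩
    have := det_ne_zero_iff_fullRank.1 (hz s hs').1.2
    rwa [hzsnd s hs'] at this
  have hflow : ∀ t ∈ Icc 0 (θ + ε), c.flow M v z.2 t z.1 = (φ (t, z)).1 := fun t ht =>
    (htraj t ht).flow_eq hM hc hτ hzΞ ht.1
  have hpair : ∀ t ∈ Icc 0 (θ + ε), φ (t, z) = ((φ (t, z)).1, z.2) := fun t ht =>
    Prod.ext rfl (hzsnd t ht)
  have hcross : ∀ t, |t - θ| < δ → ((φ (t, z)).1 ∈ c.switchSet M v z.2 ↔ τ z = t) := by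
    intro t ht
    have ht' : t ∈ Icc 0 (θ + ε) := by
      rw [abs_lt] at ht
      exact ⟨by linarith, by linarith⟩
    obtain ⟨h1, h2⟩ := hp hpzz (hball (y := t) (by
      rw [Real.dist_eq]
      exact ht.trans_le hδδ₀))
    rw [← h1]
    have h3 := hiff (φ (t, z)) h2 (hzmemX t ht') (by rwa [hzsnd t ht'])
    rwa [hzsnd t ht'] at h3
  have hτI : τ z ∈ Icc 0 (θ + ε) := by
    rw [abs_lt] at hzτ
    exact ⟨by linarith, by linarith⟩
  have hτpos : 0 < τ z := by
    rw [abs_lt] at hzτ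
    linarith
  have hsw : (φ (τ z, z)).1 ∈ c.switchSet M v z.2 := (hcross _ hzτ).2 rfl
  have hleast : IsLeast (c.hitTimes M v z.2 z.1) (τ z) := by
    refine ⟨⟨hτpos, ⟨_, htraj _ hτI⟩, by rwa [hflow _ hτI]⟩, ?_⟩
    rintro s ⟨hs0, -, hs⟩
    by_contra! hlt
    have hsI : s ∈ Icc 0 (θ + ε) := ⟨hs0.le, hlt.le.trans hτI.2⟩
    rw [hflow s hsI] at hs
    -- An earlier hit would lie either on the arc that avoids the guard or in the window where the
    -- crossing is unique.
    rcases le_or_gt s (θ - δ) with hle | hgt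
    · have hmem : φ (s, z) ∈ N := huN (mk_mem_prod (hIu ⟨hs0.le, hle⟩) hzN)
      refine hmem.2 (subset_closure ?_)
      have := hs.2
      rwa [← hzsnd s hsI] at this
    · refine hlt.ne' ((hcross s ?_).1 hs)
      rw [abs_lt] at hzτ ⊢
      exact ⟨by linarith, by linarith⟩
  refine ⟨⟨_, hleast⟩, ?_, hsw⟩
  rw [switchTime, hleast.csInf_eq, hflow _ hτI]

end ControlFamily

/-- A continuous function on a compact interval that has a continuous derivative in the interior
is differentiable up to the end points. -/
theorem hasDerivWithinAt_Icc_of_Ioo {E : Type*} [NormedAddCommGroup E] [NormedSpace ℝ E] {θ : ℝ}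
    (hθ : 0 < θ) {γ F : ℝ → E} (hγ : ContinuousOn γ (Icc 0 θ)) (hF : ContinuousOn F (Icc 0 θ))
    (hd : ∀ r ∈ Ioo 0 θ, HasDerivAt γ (F r) r) :
    ∀ r ∈ Icc 0 θ, HasDerivWithinAt γ (F r) (Icc 0 θ) r := by
  have hdiff : DifferentiableOn ℝ γ (Ioo 0 θ) := fun r hr =>
    (hd r hr).differentiableAt.differentiableWithinAt
  intro r hr
  rcases hr.1.eq_or_lt with rfl | h0
  · refine (hasDerivWithinAt_Ici_of_tendsto_deriv hdiff ((hγ 0 hr).mono Ioo_subset_Icc_self)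
      (Ioo_mem_nhdsGT hθ) ?_).mono Icc_subset_Ici_self
    have h1 : Tendsto F (𝓝[>] 0) (𝓝 (F 0)) := by
      rw [← nhdsWithin_Ioo_eq_nhdsGT hθ]
      exact (hF 0 hr).mono Ioo_subset_Icc_self
    refine h1.congr' ?_
    filter_upwards [Ioo_mem_nhdsGT hθ] with s hs
    exact (hd s hs).deriv.symm
  · rcases hr.2.eq_or_lt with rfl | h1
    · refine (hasDerivWithinAt_Iic_of_tendsto_deriv hdiff ((hγ r hr).mono Ioo_subset_Icc_self)
        (Ioo_mem_nhdsLT hθ) ?_).mono Icc_subset_Iic_self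
      have h1 : Tendsto F (𝓝[<] r) (𝓝 (F r)) := by
        rw [← nhdsWithin_Ioo_eq_nhdsLT hθ]
        exact (hF r hr).mono Ioo_subset_Icc_self
      refine h1.congr' ?_
      filter_upwards [Ioo_mem_nhdsLT hθ] with s hs
      exact (hd s hs).deriv.symm
    · exact (hd r ⟨h0, h1⟩).hasDerivWithinAt

/-! ### Switching along the periodic orbit -/

namespace HybridArc

variable {nq m : ℕ} {Con V : Type*} [DecidableEq Con] {M : HybridModel nq m Con V}
  {a : HybridArc nq m V} {T : ℝ}

theorem IsFundamentalPeriod.pos (hT : a.IsFundamentalPeriod T) : 0 < T := hT.1.1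

theorem IsFundamentalPeriod.add_nat_mul (hT : a.IsFundamentalPeriod T) (n : ℕ) {t : ℝ}
    (ht : 0 ≤ t) : a.x (t + n * T) = a.x t ∧ a.u (t + n * T) = a.u t ∧
      a.vertex (t + n * T) = a.vertex t := by
  induction n with
  | zero => simp
  | succ n ih =>
    have h0 : 0 ≤ t + n * T := by have := hT.pos; positivity
    have h1 := hT.1.2 _ h0
    have h2 : t + ((n + 1 : ℕ) : ℝ) * T = t + n * T + T := by push_cast; ring
    rw [h2, h1.1, h1.2.1, h1.2.2]
    exact ih

theorem IsFundamentalPeriod.exists_mem_Ico (hT : a.IsFundamentalPeriod T) {t : ℝ} (ht : 0 ≤ t) :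
    ∃ s ∈ Ico 0 T, a.x t = a.x s ∧ a.u t = a.u s ∧ a.vertex t = a.vertex s := by
  have hT0 := hT.pos
  have h1 := Nat.floor_le (div_nonneg ht hT0.le)
  have h2 := Nat.lt_floor_add_one (t / T)
  rw [le_div_iff₀ hT0] at h1
  rw [div_lt_iff₀ hT0] at h2
  refine ⟨t - ⌊t / T⌋₊ * T, ⟨by linarith, by linarith⟩, ?_⟩
  have := hT.add_nat_mul ⌊t / T⌋₊ (t := t - ⌊t / T⌋₊ * T) (by linarith)
  rwa [sub_add_cancel] at this

theorem IsFundamentalPeriod.mem_orbit (hT : a.IsFundamentalPeriod T) {t : ℝ} (ht : 0 ≤ t) :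
    a.x t ∈ a.orbit T (a.vertex t) := by
  obtain ⟨s, hs, hx, -, hv⟩ := hT.exists_mem_Ico ht
  exact ⟨s, hs, hv.symm, hx.symm⟩

/-- The domain does not change between switching times. -/
theorem IsSolution.vertex_eq (ha : a.IsSolution M) {t₀ t₁ : ℝ} (h0 : 0 ≤ t₀)
    (hsw : ∀ s ∈ Ioo t₀ t₁, s ∉ a.sw) : ∀ t ∈ Ico t₀ t₁, a.vertex t = a.vertex t₀ := by
  intro t ht
  -- The active domain is locally constant on a connected interval: on the right by right
  -- continuity, on the left because no switch occurs.
  refine isPreconnected_Ico.induction₂ (fun r s => a.vertex r = a.vertex s) ?_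
    (fun _ _ _ _ _ _ => Eq.trans) (fun _ _ _ _ => Eq.symm) ht ⟨le_rfl, ht.1.trans_lt ht.2⟩
  intro r hr
  have hright := (ha.right_cont r (h0.trans hr.1)).2.2
  rcases hr.1.eq_or_lt with rfl | hlt
  · filter_upwards [nhdsWithin_mono _ Ico_subset_Ici_self hright] with s hs using hs.symm
  · obtain ⟨v, _, _, hv, -, -, hns, -⟩ := ha.left_lim r (h0.trans_lt hlt)
    have hv' := (hns (hsw r ⟨hlt, hr.2⟩)).1
    apply nhdsWithin_le_nhds
    rw [← nhdsLT_sup_nhdsGE]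
    exact eventually_sup.2 ⟨hv.mono fun s hs => hv'.trans hs.symm, hright.mono fun s hs => hs.symm⟩

/-- Every time is followed by a next switching time. -/
theorem IsSolution.exists_next_switch (ha : a.IsSolution M) (hT : a.IsFundamentalPeriod T)
    {τ : V → Vec nq → ℝ} (hτ : a.IsPhasing M τ) {t : ℝ} (ht : 0 ≤ t) :
    ∃ s ∈ a.sw, t < s ∧ ∀ r ∈ Ioo t s, r ∉ a.sw := by
  -- A period without a switch would make the phasing variable strictly larger at the end than at
  -- the start, against periodicity.
  have hne : (a.sw ∩ Ioc t (t + T)).Nonempty := by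
    by_contra hemp
    rw [not_nonempty_iff_eq_empty, ← disjoint_iff_inter_eq_empty] at hemp
    have h1 := hτ.2 t (t + T) ht (by linarith [hT.pos]) hemp
    rw [(hT.1.2 t ht).1, (hT.1.2 t ht).2.2] at h1
    exact lt_irrefl _ h1
  have hfin : (a.sw ∩ Ioc t (t + T)).Finite :=
    (ha.sw_finite (t + T)).subset (inter_subset_inter_right _ Ioc_subset_Iic_self)
  obtain ⟨s, hs, hmin⟩ := exists_min_image _ id hfin hne
  refine ⟨s, hs.1, hs.2.1, fun r hr hrs => ?_⟩
  exact (hmin r ⟨hrs, hr.1, hr.2.le.trans hs.2.2⟩).not_gt hr.2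

variable (M a) in
/-- At time `s` the solution leaves the domain `v` at the state `x` with the control `u`. -/
structure IsExit (v : V) (s : ℝ) (x : State nq) (u : Vec m) : Prop where
  pos : 0 < s
  vertex_left : ∀ᶠ r in 𝓝[<] s, a.vertex r = v
  tendsto_x : Tendsto a.x (𝓝[<] s) (𝓝 x)
  tendsto_u : Tendsto a.u (𝓝[<] s) (𝓝 u)
  vertex_eq : a.vertex s = M.next v
  mem_guard : (x, u) ∈ M.guard v
  x_eq : a.x s = M.reset v x

theorem IsSolution.exists_exit (ha : a.IsSolution M) (hT : a.IsFundamentalPeriod T)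
    {τ : V → Vec nq → ℝ} (hτ : a.IsPhasing M τ) {t : ℝ} (ht : 0 ≤ t) :
    ∃ s x u, t < s ∧ (∀ r ∈ Ioo t s, r ∉ a.sw) ∧ IsExit M a (a.vertex t) s x u := by
  obtain ⟨s, hs, hts, hsw⟩ := ha.exists_next_switch hT hτ ht
  have hs0 : 0 < s := ht.trans_lt hts
  obtain ⟨v, x, u, hv, hx, hu, -, hsv⟩ := ha.left_lim s hs0
  obtain ⟨h1, h2, h3⟩ := hsv hs
  have hvt : v = a.vertex t := by
    have h4 : ∀ᶠ r in 𝓝[<] s, a.vertex r = a.vertex t := by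
      filter_upwards [Ico_mem_nhdsLT hts] with r hr using ha.vertex_eq ht hsw r hr
    obtain ⟨r, hr, hr'⟩ := (hv.and h4).exists
    exact hr.symm.trans hr'
  subst hvt
  exact ⟨s, x, u, hts, hsw, hs0, hv, hx, hu, h1, h2, h3⟩

theorem IsExit.mem_closure_orbit {v : V} {s : ℝ} {x : State nq} {u : Vec m}
    (he : IsExit M a v s x u) (hT : a.IsFundamentalPeriod T) : x ∈ closure (a.orbit T v) := by
  refine mem_closure_of_tendsto he.tendsto_x ?_
  filter_upwards [he.vertex_left, Ico_mem_nhdsLT he.pos] with r hr hr0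
  rw [← hr]
  exact hT.mem_orbit hr0.1

end HybridArc

/-! ### Parameters that reproduce the nominal control -/

namespace ControlFamily

variable {nq m : ℕ} {Con V : Type*} [DecidableEq Con] {c : ControlFamily nq V}
  {M : HybridModel nq m Con V} {a : HybridArc nq m V} {T : ℝ}

theorem GeneratesNominal.Γ_eq {ξ : c.Params} (hξ : c.GeneratesNominal M a T ξ)
    (hT : a.IsFundamentalPeriod T) {t : ℝ} (ht : 0 ≤ t) :
    c.Γ M (a.vertex t) (ξ (a.vertex t)) (a.x t) = a.u t := by
  obtain ⟨s, hs, hx, hu, hv⟩ := hT.exists_mem_Ico ht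
  rw [hx, hu, hv]
  exact hξ s hs

theorem continuousAt_Γ (hc : c.IsFamily M a T) (hτ : ∀ v, ContDiffOn ℝ ∞ (c.τ v) M.Q) {v : V}
    {ξ : Vec (c.p v)} {x : State nq} (hx : (x, ξ) ∈ c.closedLoopDomain M v) :
    ContinuousAt (fun x => c.Γ M v ξ x) x := by
  have h1 := (contDiffOn_Γ hc hτ v).contDiffAt ((isOpen_closedLoopDomain hc hτ v).mem_nhds hx)
  have h2 : ContDiffAt ℝ ∞ (fun x => c.Γ M v ξ x) x :=
    ContDiffAt.comp (f := fun x => (x, ξ)) x h1 (by fun_prop)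
  exact h2.continuousAt

section Exit

variable (hM : M.IsModel) (hT : a.IsFundamentalPeriod T)
  (hc : c.IsFamily M a T) (hτ : ∀ v, ContDiffOn ℝ ∞ (c.τ v) M.Q) {ξ : c.Params}
  (hξ : ξ ∈ c.allParams) (hgen : c.GeneratesNominal M a T ξ) {v : V} {s : ℝ} {x : State nq}
  {u : Vec m} (he : HybridArc.IsExit M a v s x u)
include hM hT hc hξ he

theorem exit_mem_Xcl : x ∈ c.Xcl M v (ξ v) :=
  ⟨(hM.adm_subset v (hM.guard_subset v he.mem_guard)).1,
    hc.fullRank v _ (hξ v) _ (he.mem_closure_orbit hT)⟩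

include hτ hgen

/-- Before the exit, feedback and nominal control agree along the orbit. The exit point is only a
limit of orbit points, but full rank on the closure makes `Γ` continuous there, so the left limits
agree. -/
theorem Γ_exit : c.Γ M v (ξ v) x = u := by
  have hmem := mem_closedLoopDomain hM (hξ v) (exit_mem_Xcl hM hT hc hξ he)
  have h1 : Tendsto (fun r => c.Γ M v (ξ v) (a.x r)) (𝓝[<] s) (𝓝 (c.Γ M v (ξ v) x)) :=
    (continuousAt_Γ hc hτ hmem).tendsto.comp he.tendsto_x
  have h2 : (fun r => c.Γ M v (ξ v) (a.x r)) =ᶠ[𝓝[<] s] a.u := by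
    filter_upwards [he.vertex_left, Ico_mem_nhdsLT he.pos] with r hr hr0
    have := hgen.Γ_eq hT hr0.1
    rwa [hr] at this
  exact tendsto_nhds_unique (h1.congr' h2) he.tendsto_u

theorem exit_mem_switchSet : x ∈ c.switchSet M v (ξ v) := by
  refine ⟨exit_mem_Xcl hM hT hc hξ he, ?_⟩
  rw [Γ_exit hM hT hc hτ hξ hgen he]
  exact he.mem_guard

/-- The point at which the orbit leaves a domain is its only point on the switching manifold. -/
theorem closure_orbit_inter_switchSet {ξs : c.Params} (hξs : ξs ∈ c.allParams)
    (hnom : c.GeneratesNominal M a T ξs) (htrans : c.Transversal M a T ξs) :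
    closure (a.orbit T v) ∩ c.switchSet M v (ξ v) = {x} ∧
      c.fcl M v (ξ v) x ∉ tangentConeAt ℝ (c.switchSet M v (ξ v)) x := by
  obtain ⟨y, hy, hyt⟩ := htrans v (ξ v) (hξ v)
  have hxy : x = y := by
    have : x ∈ closure (a.orbit T v) ∩ c.switchSet M v (ξ v) :=
      ⟨he.mem_closure_orbit hT, exit_mem_switchSet hM hT hc hτ hξ hgen he⟩
    rwa [hy] at this
  subst hxy
  refine ⟨hy, ?_⟩
  -- Both parameter vectors give the control `u` at the exit point, so the two closed-loop fields
  -- coincide there and transversality carries over.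
  rwa [fcl, Γ_exit hM hT hc hτ hξ hgen he, ← Γ_exit hM hT hc hτ hξs hnom he]

end Exit

/-- Between two switching times the orbit is a closed-loop trajectory, that meets the guard only
at its end. -/
theorem exists_stay (hM : M.IsModel) (ha : a.IsSolution M) (hT : a.IsFundamentalPeriod T)
    (hτ : a.IsPhasing M c.τ) (hc : c.IsFamily M a T) {ξs : c.Params} (hξs : ξs ∈ c.allParams)
    (hnom : c.GeneratesNominal M a T ξs) (htrans : c.Transversal M a T ξs) {ξ : c.Params}
    (hξ : ξ ∈ c.allParams) (hgen : c.GeneratesNominal M a T ξ) {w : V} {t₀ : ℝ} {x₀ : State nq}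
    {u₀ : Vec m} (h₀ : HybridArc.IsExit M a w t₀ x₀ u₀) :
    ∃ θ > 0, ∃ γ : ℝ → State nq, ∃ s x u, HybridArc.IsExit M a (M.next w) s x u ∧ γ θ = x ∧
      c.IsTrajectory M (M.next w) (ξ (M.next w)) (M.reset w x₀) θ γ ∧
      ∀ t ∈ Ico 0 θ, (γ t, c.Γ M (M.next w) (ξ (M.next w)) (γ t)) ∉ closure (M.guard (M.next w)) := by
  obtain ⟨t₁, x, u, hlt, hsw, he⟩ := ha.exists_exit hT hτ h₀.pos.le
  have hv := h₀.vertex_eq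
  have hvert := ha.vertex_eq h₀.pos.le hsw
  rw [hv] at he hvert
  set v := M.next w
  have hθ : 0 < t₁ - t₀ := sub_pos.2 hlt
  have hin : ∀ {r}, r ∈ Ico 0 (t₁ - t₀) → t₀ + r ∈ Ico t₀ t₁ := fun hr =>
    ⟨by linarith [hr.1], by linarith [hr.2]⟩
  have hpos : ∀ {r}, r ∈ Ico 0 (t₁ - t₀) → 0 < t₀ + r := fun hr => h₀.pos.trans_le (hin hr).1
  -- At the final time the value is the left limit `x`, since the orbit itself has already been
  -- reset.
  let γ : ℝ → State nq := fun r => if r < t₁ - t₀ then a.x (t₀ + r) else x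
  have hγ1 : γ (t₁ - t₀) = x := if_neg (lt_irrefl _)
  have hγlt : ∀ {r}, r ∈ Ico 0 (t₁ - t₀) → γ r = a.x (t₀ + r) := fun hr => if_pos hr.2
  have hΓ : ∀ {r}, r ∈ Ico 0 (t₁ - t₀) → c.Γ M v (ξ v) (a.x (t₀ + r)) = a.u (t₀ + r) := by
    intro r hr
    have := hgen.Γ_eq hT (hpos hr).le
    rwa [hvert _ (hin hr)] at this
  have horb : ∀ {r}, r ∈ Ico 0 (t₁ - t₀) → a.x (t₀ + r) ∈ closure (a.orbit T v) := by
    intro r hr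
    have := hT.mem_orbit (hpos hr).le
    rw [hvert _ (hin hr)] at this
    exact subset_closure this
  have hadm : ∀ {r}, r ∈ Ico 0 (t₁ - t₀) → (a.x (t₀ + r), a.u (t₀ + r)) ∈ M.adm v := by
    intro r hr
    have := ha.mem_adm _ (hpos hr).le
    rwa [hvert _ (hin hr)] at this
  have hXcl : ∀ r ∈ Icc 0 (t₁ - t₀), γ r ∈ c.Xcl M v (ξ v) := by
    intro r hr
    rcases hr.2.eq_or_lt with rfl | hlt'
    · rw [hγ1]
      exact exit_mem_Xcl hM hT hc hξ he
    · have hr' : r ∈ Ico 0 (t₁ - t₀) := ⟨hr.1, hlt'⟩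
      rw [hγlt hr']
      exact ⟨(hM.adm_subset v (hadm hr')).1, hc.fullRank v _ (hξ v) _ (horb hr')⟩
  have hder : ∀ r ∈ Ioo 0 (t₁ - t₀), HasDerivAt γ (c.fcl M v (ξ v) (γ r)) r := by
    intro r hr
    have hr' : r ∈ Ico 0 (t₁ - t₀) := ⟨hr.1.le, hr.2⟩
    have h1 := (ha.ode (t₀ + r) (hpos hr').le
      (hsw _ ⟨by linarith [hr.1], (hin hr').2⟩)).hasDerivAt (Ici_mem_nhds (hpos hr'))
    rw [hvert _ (hin hr'), ← hΓ hr', ← hγlt hr'] at h1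
    refine (h1.comp_const_add t₀ r).congr_of_eventuallyEq ?_
    filter_upwards [Ioo_mem_nhds hr.1 hr.2] with s hs using hγlt ⟨hs.1.le, hs.2⟩
  have hcont : ContinuousOn γ (Icc 0 (t₁ - t₀)) := by
    intro r hr
    rcases hr.2.eq_or_lt with rfl | hlt'
    · rw [continuousWithinAt_Icc_iff_Iic hθ, ← continuousWithinAt_Iio_iff_Iic, ContinuousWithinAt,
        hγ1]
      have h1 : Tendsto (fun r => t₀ + r) (𝓝[<] (t₁ - t₀)) (𝓝[<] t₁) := by
        refine tendsto_nhdsWithin_iff.2 ⟨?_, ?_⟩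
        · have : Continuous fun r : ℝ => t₀ + r := by fun_prop
          simpa using (this.tendsto (t₁ - t₀)).mono_left nhdsWithin_le_nhds
        · filter_upwards [self_mem_nhdsWithin] with r hr
          have hr : r < t₁ - t₀ := hr
          change t₀ + r < t₁
          linarith
      refine (he.tendsto_x.comp h1).congr' ?_
      filter_upwards [Ico_mem_nhdsLT hθ] with r hr using (hγlt hr).symm
    · rcases hr.1.eq_or_lt with rfl | h0'
      · have h1 : ContinuousWithinAt (fun r => a.x (t₀ + r)) (Icc 0 (t₁ - t₀)) 0 := by
          have h2 := (ha.right_cont t₀ h₀.pos.le).1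
          refine ContinuousWithinAt.comp (t := Ici t₀) (by simpa using h2) (by fun_prop) ?_
          intro r hr
          change t₀ ≤ t₀ + r
          linarith [hr.1]
        refine h1.congr_of_eventuallyEq ?_ (hγlt ⟨le_rfl, hθ⟩)
        filter_upwards [self_mem_nhdsWithin, nhdsWithin_le_nhds (Iio_mem_nhds hθ)] with r hr hr'
          using hγlt ⟨hr.1, hr'⟩
      · exact (hder r ⟨h0', hlt'⟩).continuousAt.continuousWithinAt
  have hfcont : ContinuousOn (fun r => c.fcl M v (ξ v) (γ r)) (Icc 0 (t₁ - t₀)) :=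
    (contDiffOn_fcl hc hτ.1 v).continuousOn.comp (hcont.prodMk continuousOn_const) fun r hr =>
      mem_closedLoopDomain hM (hξ v) (hXcl r hr)
  refine ⟨t₁ - t₀, hθ, γ, t₁, x, u, he, hγ1, ⟨?_, fun r hr => ⟨hXcl r hr,
    hasDerivWithinAt_Icc_of_Ioo hθ hcont hfcont hder r hr⟩⟩, ?_⟩
  · rw [hγlt ⟨le_rfl, hθ⟩, add_zero, h₀.x_eq]
  -- A point in the closure of the guard would be in the guard, hence equal to the exit point `x`;
  -- but its phase is strictly smaller than that of `x`. This covers `r = 0` too, where the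
  -- definition of a solution does not exclude the guard.
  · intro r hr hcl
    rw [hγlt hr, hΓ hr] at hcl
    have hg := hM.guard_closed v ⟨hcl, hadm hr⟩
    have hmem : a.x (t₀ + r) ∈ closure (a.orbit T v) ∩ c.switchSet M v (ξ v) := by
      refine ⟨horb hr, ?_, ?_⟩
      · rw [← hγlt hr]
        exact hXcl r ⟨hr.1, hr.2.le⟩
      · rwa [hΓ hr]
    rw [(closure_orbit_inter_switchSet hM hT hc hτ.1 hξ hgen he hξs hnom htrans).1] at hmem
    have hxr : a.x (t₀ + r) = x := hmem
    have hphase : ∀ r₁ r₂, r₁ ∈ Ico 0 (t₁ - t₀) → r₂ ∈ Ico 0 (t₁ - t₀) → r₁ < r₂ →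
        c.τ v (a.x (t₀ + r₁)).1 < c.τ v (a.x (t₀ + r₂)).1 := by
      intro r₁ r₂ h1 h2 h12
      have := hτ.2 (t₀ + r₁) (t₀ + r₂) (hpos h1).le (by linarith) (by
        rw [Set.disjoint_left]
        intro s hs hs'
        exact hsw s ⟨by linarith [h1.1, hs'.1], by linarith [h2.2, hs'.2]⟩ hs)
      rwa [hvert _ (hin h1), hvert _ (hin h2)] at this
    have hτcont : Tendsto (fun s => c.τ v (γ s).1) (𝓝[<] (t₁ - t₀)) (𝓝 (c.τ v x.1)) := by
      have h1 : ContinuousAt (c.τ v) x.1 := ((hτ.1 v).contDiffAt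
        (M.isOpen_Q.mem_nhds (exit_mem_Xcl hM hT hc hξ he).1.1)).continuousAt
      have h2 := (hcont (t₁ - t₀) ⟨hθ.le, le_rfl⟩).mono Ico_subset_Icc_self
      rw [ContinuousWithinAt, hγ1, nhdsWithin_Ico_eq_nhdsLT hθ] at h2
      exact h1.tendsto.comp ((continuous_fst.tendsto x).comp h2)
    -- The limit preserves only weak inequalities; an intermediate time supplies the strict one.
    obtain ⟨r₁, hr₁, hr₁'⟩ := exists_between hr.2
    have hr₁I : r₁ ∈ Ico 0 (t₁ - t₀) := ⟨hr.1.trans hr₁.le, hr₁'⟩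
    have h1 := hphase r r₁ hr hr₁I hr₁
    have h2 : c.τ v (a.x (t₀ + r₁)).1 ≤ c.τ v x.1 := by
      refine ge_of_tendsto hτcont ?_
      filter_upwards [Ioo_mem_nhdsLT hr₁'] with s hs
      have hsI : s ∈ Ico 0 (t₁ - t₀) := ⟨hr₁I.1.trans hs.1.le, hs.2⟩
      rw [hγlt hsI]
      exact (hphase r₁ s hr₁I hsI hs.1).le
    rw [hxr] at h1
    exact absurd h1 h2.not_gt

/-- The orbit visits and leaves every domain. -/
theorem exists_exit (ha : a.IsSolution M) (hT : a.IsFundamentalPeriod T)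
    (hτ : a.IsPhasing M c.τ) {ξs : c.Params} (hξs : ξs ∈ c.allParams)
    (htrans : c.Transversal M a T ξs) (v : V) : ∃ s x u, HybridArc.IsExit M a v s x u := by
  obtain ⟨y, hy, -⟩ := htrans v (ξs v) (hξs v)
  have hyc : y ∈ closure (a.orbit T v) := by
    have := mem_singleton y
    rw [← hy] at this
    exact this.1
  obtain ⟨-, t, ht, rfl, -⟩ := closure_nonempty_iff.1 ⟨y, hyc⟩
  obtain ⟨s, x, u, -, -, he⟩ := ha.exists_exit hT hτ ht.1
  exact ⟨s, x, u, he⟩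

end ControlFamily

/-! ### Composition around the cycle -/

namespace ControlFamily

variable {nq m : ℕ} {Con V : Type*} [DecidableEq Con] {c : ControlFamily nq V}
  {M : HybridModel nq m Con V} {a : HybridArc nq m V} {T : ℝ}

theorem start_next (w : V) (x : State nq) : start M (M.next w) x = M.reset w x := by
  simp [start]

/-- Near the orbit, the transition through one domain is the restriction of a `C²` map. -/
theorem exists_local_step [Fintype V] (hM : M.IsModel) (ha : a.IsSolution M)
    (hT : a.IsFundamentalPeriod T) (hτ : a.IsPhasing M c.τ) (hc : c.IsFamily M a T)
    {ξs : c.Params} (hξs : ξs ∈ c.allParams) (hnom : c.GeneratesNominal M a T ξs)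
    (hreg : c.RegularSections M) (htrans : c.Transversal M a T ξs) {ξ₀ : c.Params}
    (hξ₀ : ξ₀ ∈ c.allParams) (hgen : c.GeneratesNominal M a T ξ₀) {w v : V} (hwv : M.next w = v)
    {sw sv : ℝ} {xw xv : State nq} {uw uv : Vec m} (hw : HybridArc.IsExit M a w sw xw uw)
    (hv : HybridArc.IsExit M a v sv xv uv) :
    ∃ S : State nq × c.Params → State nq, ContDiffAt ℝ 2 S (xw, ξ₀) ∧ S (xw, ξ₀) = xv ∧
      ∀ᶠ z in 𝓝 (xw, ξ₀), z.1 ∈ c.switchSet M w (z.2 w) →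
        (∃ t, IsLeast (c.hitTimes M v (z.2 v) (start M v z.1)) t) ∧
        c.genPoincare M v (z.2 v) z.1 = S z ∧ S z ∈ c.switchSet M v (z.2 v) := by
  subst hwv
  obtain ⟨θ, hθ, γ, s, x, u, he, hγθ, hγ, hguard⟩ :=
    exists_stay hM ha hT hτ hc hξs hnom htrans hξ₀ hgen hw
  obtain ⟨h1, h2⟩ := closure_orbit_inter_switchSet hM hT hc hτ.1 hξ₀ hgen hv hξs hnom htrans
  -- The orbit may visit a domain several times per period; the single-point hypothesis makes all
  -- these visits end at the same state.
  have hxv : x = xv := by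
    have : x ∈ closure (a.orbit T (M.next w)) ∩ c.switchSet M (M.next w) (ξ₀ (M.next w)) :=
      ⟨he.mem_closure_orbit hT, exit_mem_switchSet hM hT hc hτ.1 hξ₀ hgen he⟩
    rwa [h1] at this
  subst hxv
  obtain ⟨Pe, hPe, hPe0, hev⟩ := exists_local_poincare hM hc hτ.1 hreg (hξ₀ (M.next w)) hθ hγ hguard
    (by rw [hγθ]; exact exit_mem_switchSet hM hT hc hτ.1 hξ₀ hgen he) (by rwa [hγθ])
  have hreset : ContDiffAt ℝ 2 (M.reset w) xw := by
    have hX := hM.reset_mem w _ hw.mem_guard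
    -- Smoothness of the reset at `xw` depends on the configuration only, which the reset preserves,
    -- so regularity after the reset suffices.
    have hmem : xw ∈ M.regularState (M.contact (M.next w)) := by
      have := hM.regularState_of_mem_X hX
      change (M.reset w xw).1 ∈ M.regular _ at this
      rwa [M.reset_fst] at this
    exact ((M.contDiffOn_reset w).contDiffAt ((M.isOpen_regularState _).mem_nhds hmem)).of_le
      ENat.LEInfty.out
  have hinner : ContDiffAt ℝ 2
      (fun z : State nq × c.Params => (M.reset w z.1, z.2 (M.next w))) (xw, ξ₀) := by
    refine (ContDiffAt.comp (xw, ξ₀) (f := Prod.fst) hreset contDiffAt_fst).prodMk ?_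
    exact contDiffAt_pi.1 contDiffAt_snd (M.next w)
  refine ⟨fun z => Pe (M.reset w z.1, z.2 (M.next w)), ?_, ?_, ?_⟩
  · exact ContDiffAt.comp (xw, ξ₀) (f := fun z : State nq × c.Params =>
      (M.reset w z.1, z.2 (M.next w))) hPe hinner
  · exact hPe0.trans hγθ
  · filter_upwards [hinner.continuousAt.eventually hev] with z hz hzsw
    have h := hz (hM.reset_mem w _ hzsw.2)
    rw [start_next, genPoincare, start_next]
    exact h

/-- Induction on `k`. Membership of the value in the current switching manifold is carried along
because the next step applies only there; the parameters are transported unchanged. -/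
theorem exists_local_partialReturn [Fintype V] (hM : M.IsModel) (ha : a.IsSolution M)
    (hT : a.IsFundamentalPeriod T) (hτ : a.IsPhasing M c.τ) (hc : c.IsFamily M a T)
    {ξs : c.Params} (hξs : ξs ∈ c.allParams) (hnom : c.GeneratesNominal M a T ξs)
    (hreg : c.RegularSections M) (htrans : c.Transversal M a T ξs) {ξ₀ : c.Params}
    (hξ₀ : ξ₀ ∈ c.allParams) (hgen : c.GeneratesNominal M a T ξ₀) {s : V → ℝ} {x : V → State nq}
    {u : V → Vec m} (hex : ∀ v, HybridArc.IsExit M a v (s v) (x v) (u v)) (v₁ : V) (k : ℕ) :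
    ∃ P : State nq × c.Params → State nq, ContDiffAt ℝ 2 P (x v₁, ξ₀) ∧
      P (x v₁, ξ₀) = x ((M.next ^ k) v₁) ∧
      ∀ᶠ z in 𝓝 (x v₁, ξ₀), z.1 ∈ c.switchSet M v₁ (z.2 v₁) →
        (∀ j < k, ∃ t, IsLeast (c.hitTimes M ((M.next ^ (j + 1)) v₁) (z.2 _)
          (start M ((M.next ^ (j + 1)) v₁) (c.partialReturn M v₁ z.2 j z.1))) t) ∧
        c.partialReturn M v₁ z.2 k z.1 = P z ∧
        P z ∈ c.switchSet M ((M.next ^ k) v₁) (z.2 _) := by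
  induction k with
  | zero =>
    exact ⟨Prod.fst, contDiffAt_fst, rfl, Eventually.of_forall fun z hz =>
      ⟨fun j hj => absurd hj (Nat.not_lt_zero j), rfl, hz⟩⟩
  | succ k ih =>
    obtain ⟨P, hP, hP0, hev⟩ := ih
    have hnext : M.next ((M.next ^ k) v₁) = (M.next ^ (k + 1)) v₁ := by
      rw [pow_succ']
      rfl
    obtain ⟨S, hS, hS0, hSev⟩ := exists_local_step hM ha hT hτ hc hξs hnom hreg htrans hξ₀ hgen
      hnext (hex _) (hex _)
    rw [← hP0] at hS hS0 hSev
    have hinner : ContDiffAt ℝ 2 (fun z : State nq × c.Params => (P z, z.2)) (x v₁, ξ₀) :=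
      hP.prodMk contDiffAt_snd
    refine ⟨fun z => S (P z, z.2), ContDiffAt.comp (x v₁, ξ₀)
      (f := fun z : State nq × c.Params => (P z, z.2)) hS hinner, hS0, ?_⟩
    filter_upwards [hev, hinner.continuousAt.eventually hSev] with z hz hzS hzsw
    obtain ⟨h1, h2, h3⟩ := hz hzsw
    obtain ⟨h4, h5, h6⟩ := hzS h3
    refine ⟨fun j hj => ?_, ?_, h6⟩
    · rcases Nat.lt_succ_iff_lt_or_eq.1 hj with hj | rfl
      · exact h1 j hj
      · rw [h2]
        exact h4
    · rw [partialReturn, h2]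
      exact h5

end ControlFamily

end

/-! ### The full return map and its Jacobian -/

theorem theorem1 {nq m : ℕ} {Con V : Type*} [DecidableEq Con] [Fintype V]
    -- the open-loop multi-domain hybrid model
    (M : HybridModel nq m Con V) (hM : M.IsModel)
    -- a nominal periodic solution
    (a : HybridArc nq m V) (ha : a.IsSolution M) (T : ℝ) (hT : a.IsFundamentalPeriod T)
    -- a phasing variable and the family of virtual constraint controllers
    (c : ControlFamily nq V) (hτ : a.IsPhasing M c.τ) (hc : c.IsFamily M a T)
    -- nominal parameters
    (ξs : c.Params) (hξs : ξs ∈ c.allParams) (hnom : c.GeneratesNominal M a T ξs)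
    -- regular switching manifolds, transversality
    (hreg : c.RegularSections M) (htrans : c.Transversal M a T ξs)
    (v1 : V) :
    ∃ (Ξhat : Set c.Params) (x1 : State nq),
      Ξhat ⊆ c.allParams ∧ ξs ∈ Ξhat ∧
      (∀ ξ ∈ c.allParams, c.GeneratesNominal M a T ξ → ξ ∈ Ξhat) ∧
      -- `x1` is a point of the orbit, and a common fixed point of the return maps
      x1 ∈ closure (a.orbit T v1) ∧
      (∀ ξ ∈ Ξhat, x1 ∈ c.switchSet M v1 (ξ v1) ∧ c.ReturnDefined M v1 ξ x1 ∧
        c.returnMap M v1 ξ x1 = x1) ∧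
      -- near `(x1, ξ)` the return map is a self-map of the section, and the restriction of
      -- a map that is twice continuously differentiable in the state and the parameters jointly
      (∀ ξ ∈ Ξhat, ∃ Pext : State nq × c.Params → State nq, ContDiffAt ℝ 2 Pext (x1, ξ) ∧
        ∀ᶠ z in 𝓝 (x1, ξ), z.1 ∈ c.switchSet M v1 (z.2 v1) →
          c.ReturnDefined M v1 z.2 z.1 ∧
          c.returnMap M v1 z.2 z.1 ∈ c.switchSet M v1 (z.2 v1) ∧
          c.returnMap M v1 z.2 z.1 = Pext z) ∧
      -- its Jacobian at `x1`, along the section, exists and is differentiable on `Ξhat`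
      ∃ Ψ : c.Params → (State nq →L[ℝ] State nq),
        (∀ ξ ∈ Ξhat, HasFDerivWithinAt (c.returnMap M v1 ξ) (Ψ ξ)
          (c.switchSet M v1 (ξ v1)) x1) ∧
        DifferentiableOn ℝ Ψ Ξhat := by
  classical
  choose s x u hex using ControlFamily.exists_exit ha hT hτ hξs htrans
  have hcard : (M.next ^ Fintype.card V) v1 = v1 := by
    have h : M.next.IsCycleOn ((Finset.univ : Finset V) : Set V) := by
      rw [Finset.coe_univ]
      exact hM.cycle
    exact h.pow_card_apply (Finset.mem_univ v1)
  have hlocal : ∀ ξ ∈ {ξ | ξ ∈ c.allParams ∧ c.GeneratesNominal M a T ξ},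
      ∃ P : State nq × c.Params → State nq, ContDiffAt ℝ 2 P (x v1, ξ) ∧ P (x v1, ξ) = x v1 ∧
        ∀ᶠ z in 𝓝 (x v1, ξ), z.1 ∈ c.switchSet M v1 (z.2 v1) →
          c.ReturnDefined M v1 z.2 z.1 ∧ c.returnMap M v1 z.2 z.1 ∈ c.switchSet M v1 (z.2 v1) ∧
          c.returnMap M v1 z.2 z.1 = P z := by
    rintro ξ ⟨hξ, hgen⟩
    obtain ⟨P, hP, hP0, hev⟩ := ControlFamily.exists_local_partialReturn hM ha hT hτ hc hξs hnom
      hreg htrans hξ hgen hex v1 (Fintype.card V)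
    rw [hcard] at hP0
    refine ⟨P, hP, hP0, ?_⟩
    filter_upwards [hev] with z hz hzsw
    obtain ⟨h1, h2, h3⟩ := hz hzsw
    rw [hcard, ← h2] at h3
    exact ⟨h1, h3, h2⟩
  have hmem : ∀ ξ ∈ {ξ | ξ ∈ c.allParams ∧ c.GeneratesNominal M a T ξ},
      x v1 ∈ c.switchSet M v1 (ξ v1) := fun ξ hξ =>
    ControlFamily.exit_mem_switchSet hM hT hc hτ.1 hξ.1 hξ.2 (hex v1)
  refine ⟨{ξ | ξ ∈ c.allParams ∧ c.GeneratesNominal M a T ξ}, x v1, fun ξ hξ => hξ.1,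
    ⟨hξs, hnom⟩, fun ξ hξ hgen => ⟨hξ, hgen⟩, (hex v1).mem_closure_orbit hT, ?_, ?_, ?_⟩
  · intro ξ hξ
    obtain ⟨P, -, hP0, hev⟩ := hlocal ξ hξ
    obtain ⟨h1, -, h2⟩ := hev.self_of_nhds (hmem ξ hξ)
    exact ⟨hmem ξ hξ, h1, h2.trans hP0⟩
  · intro ξ hξ
    obtain ⟨P, hP, -, hev⟩ := hlocal ξ hξ
    exact ⟨P, hP, hev⟩
  · suffices h : ∃ Ψ : c.Params → (State nq →L[ℝ] State nq),
        DifferentiableOn ℝ Ψ {ξ | ξ ∈ c.allParams ∧ c.GeneratesNominal M a T ξ} ∧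
        ∀ ξ ∈ {ξ | ξ ∈ c.allParams ∧ c.GeneratesNominal M a T ξ},
          Ψ ξ ∈ {L : State nq →L[ℝ] State nq | HasFDerivWithinAt (c.returnMap M v1 ξ) L
            (c.switchSet M v1 (ξ v1)) (x v1)} by
      obtain ⟨Ψ, hΨ, hΨt⟩ := h
      exact ⟨Ψ, hΨt, hΨ⟩
    refine exists_differentiableOn_forall_mem_convex
      (t := fun ξ => {L : State nq →L[ℝ] State nq | HasFDerivWithinAt (c.returnMap M v1 ξ) L
        (c.switchSet M v1 (ξ v1)) (x v1)}) ?_ ?_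
    -- Two derivatives along the section may differ off its tangent directions, but their convex
    -- combination is a derivative of the same combination of the map with itself.
    · intro ξ L hL L' hL' r r' hr hr' hrr
      have h : HasFDerivWithinAt (fun y => r • c.returnMap M v1 ξ y + r' • c.returnMap M v1 ξ y)
          (r • L + r' • L') (c.switchSet M v1 (ξ v1)) (x v1) :=
        (HasFDerivWithinAt.const_smul hL r).add (HasFDerivWithinAt.const_smul hL' r')
      simp only [← add_smul, hrr, one_smul] at h
      exact h
    · intro ξ₀ hξ₀
      obtain ⟨P, hP, -, hev⟩ := hlocal ξ₀ hξ₀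
      -- The state derivative of a `C²` extension is `C¹` in the parameters.
      refine ⟨fun ξ => fderiv ℝ (fun y => P (y, ξ)) (x v1), ?_, ?_⟩
      · refine ContDiffAt.fderiv (f := fun ξ y => P (y, ξ)) (g := fun _ => x v1) (n := 2) ?_
          contDiffAt_const (by norm_num)
        exact ContDiffAt.comp (ξ₀, x v1) (f := fun p : c.Params × State nq => (p.2, p.1)) hP
          (by fun_prop)
      · have hcont : Tendsto (fun ξ : c.Params => (x v1, ξ)) (𝓝 ξ₀) (𝓝 (x v1, ξ₀)) :=
          (Continuous.prodMk_right (x v1)).tendsto ξ₀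
        -- The extension built at `ξ₀` serves all nearby `ξ`, because the base point `x v1` is
        -- common to all of them.
        have hd : ∀ᶠ z in 𝓝 (x v1, ξ₀), ContDiffAt ℝ 2 P z := hP.eventually (by simp)
        filter_upwards [hcont.eventually hd, hcont.eventually (eventually_eventually_nhds.2 hev)]
          with ξ hξd hξev hξ
        have hy : Tendsto (fun y : State nq => (y, ξ)) (𝓝 (x v1)) (𝓝 (x v1, ξ)) :=
          (Continuous.prodMk_left ξ).tendsto (x v1)
        have hdiff : DifferentiableAt ℝ (fun y => P (y, ξ)) (x v1) :=
          DifferentiableAt.comp (x v1) (f := fun y => (y, ξ)) (hξd.differentiableAt two_ne_zero)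
            (by fun_prop)
        refine hdiff.hasFDerivAt.hasFDerivWithinAt.congr_of_eventuallyEq ?_ ?_
        · filter_upwards [nhdsWithin_le_nhds (hy.eventually hξev), self_mem_nhdsWithin] with y h1 h2
          exact (h1 h2).2.2
        · exact (hξev.self_of_nhds (hmem ξ hξ)).2.2
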